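/- **Theorem (high-gain optimal output consensus of integrators with real-time gradients).** Let $N,n\ge 1$ and $m\ge 0$ be integers, and let $\mathcal G$ be a connected weighted undirected graph on $\{1,\dots,N\}$ with weights $a_{ij}=a_{ji}\ge 0$, $a_{ii}=0$ ($a_{ij}>0$ iff $i,j$ are joined by an edge) and Laplacian $L$. Let $\omega,\vartheta>0$ and let $f_1,\dots,f_N:\mathbb R^m\to\mathbb R$ be differentiable with $(\nabla f_i(a)-\nabla f_i(b))^\top(a-b)\ge\omega\|a-b\|^2$ and $\|\nabla f_i(a)-\nabla f_i(b)\|\le\vartheta\|a-b\|$ for all $a,b$. Let $c_0,\dots,c_{n-1}\in\mathbb R$ be such that all complex roots of $s^n+\sum_{k=0}^{n-1}c_ks^k$ have negative real part. For $\epsilon>0$ consider, on $[0,\infty)$, the agents $x_i^{(n)}=v_i$, $y_i=x_i\in\mathbb R^m$ in closed loop with $$v_i=-\frac1{\epsilon^n}\Big[c_0(x_i-z_i)+\sum_{k=1}^{n-1}\epsilon^kc_kx_i^{(k)}\Big],\quad \dot z_i=-\nabla f_i(y_i)-\sum_{j=1}^Na_{ij}(\lambda_i-\lambda_j),\quad \dot\lambda_i=\sum_{j=1}^Na_{ij}(z_i-z_j).$$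 Then $\sum_{i=1}^N f_i$ has exactly one minimizer $y^*\in\mathbb R^m$, and there is $\epsilon^*>0$, given explicitly below, such that for every $\epsilon\in(0,\epsilon^*)$: a trajectory on $[0,\infty)$ exists from every initial state; along every trajectory all of $x_i,\dot x_i,\dots,x_i^{(n-1)},z_i,\lambda_i$ are bounded and $y_i(t)\to y^*$ for all $i$; and there is $\alpha>0$ such that every trajectory satisfies, for some constant $C$, $\|y_i(t)-y^*\|\le Ce^{-\alpha t}$ for all $t\ge 0$ and all $i$. *The constant $\epsilon^*$.* Let $r=\frac1{\sqrt N}\mathbf 1_N$, let $A$ be the $n\times n$ companion matrix with last row $(-c_0,\dots,-c_{n-1})$ (and superdiagonal ones in the other rows), $A_m=A\otimes I_m$, $b_m=\mathrm{col}(-1,0,\dots,0)\otimes I_m$. Consider data consisting of: - a matrix $R\in\mathbb R^{N\times(N-1)}$ with $R^\top r=0$, $R^\top R=I$, $RR^\top=I-rr^\top$, and a positive definite $P$ with $A_m^\top P+PA_m=-I$; - a $C^1$ function $V$ of $\hat z=\mathrm{col}(\bar z,\mu)\in\mathbb R^{Nm}\times\mathbb R^{(N-1)m}$ and constants $\hat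 c_1,\dots,\hat c_4>0$ with $\hat c_1\|\hat z\|^2\le V(\hat z)\le\hat c_2\|\hat z\|^2$, $\|\nabla V(\hat z)\|\le\hat c_4\|\hat z\|$, and derivative of $V$ at $\hat z$ along the vector field $\big(-h-(LR\otimes I_m)\mu,\ (R^\top L\otimes I_m)\bar z\big)$ at most $-\hat c_3\|\hat z\|^2$, where $h_i=\nabla f_i(y^*+\bar z_i)-\nabla f_i(y^*)$; - constants $\bar\vartheta_2,\bar\vartheta_3>0$ such that $\|-h-\Delta-(LR\otimes I_m)\mu\|\le\bar\vartheta_2\|\hat x\|+\bar\vartheta_3\|\hat z\|$ for all $\hat x=(\hat x_{i,k})_{1\le i\le N,\,0\le k\le n-1}\in\mathbb R^{Nnm}$ and all $\hat z$, where $\Delta_i=\nabla f_i(y^*+\bar z_i+\hat x_{i,0})-\nabla f_i(y^*+\bar z_i)$. Put $\hat\vartheta_2=2\bar\vartheta_2\|I_N\otimes Pb_m\|$, $\hat\vartheta_3=2\bar\vartheta_3\|I_N\otimes Pb_m\|$, $\hat\vartheta_4=\hat\vartheta_3+\hat c_4\vartheta$ and $$\epsilon^*=\frac{2\hat c_3}{2\hat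 c_3\hat\vartheta_2+\hat\vartheta_4^2}.$$ Such data exist with $\epsilon^*>0$, and the conclusions above hold for all $\epsilon\in(0,\epsilon^*)$ for every choice of such data. -/

import Mathlib

open scoped Kronecker

noncomputable section

namespace OptimalConsensus

/-- The Euclidean space of dimension `m`. -/
abbrev Vec (m : ℕ) : Type := EuclideanSpace ℝ (Fin m)

/-! ### Weighted undirected graphs -/

/-- A weighted undirected graph without self-loops on the nodes `Fin N`, given by its weighted
adjacency matrix. Two nodes are joined by an edge iff the weight between them is positive. -/
structure WeightedGraph (N : ℕ) where
  weight : Matrix (Fin N) (Fin N) ℝ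
  weight_symm : ∀ i j, weight i j = weight j i
  weight_nonneg : ∀ i j, 0 ≤ weight i j
  weight_self : ∀ i, weight i i = 0

namespace WeightedGraph

variable {N : ℕ}

/-- The underlying simple graph. -/
def toSimpleGraph (G : WeightedGraph N) : SimpleGraph (Fin N) where
  Adj i j := 0 < G.weight i j
  symm := ⟨fun i j h => by rw [G.weight_symm j i]; exact h⟩
  loopless := ⟨fun i h => by rw [G.weight_self i] at h; exact lt_irrefl _ h⟩

/-- There is a path between any two nodes (and there is at least one node). -/
def IsConnected (G : WeightedGraph N) : Prop := G.toSimpleGraph.Connected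

/-- The Laplacian: weighted degrees on the diagonal, `-a i j` off the diagonal. -/
def laplacian (G : WeightedGraph N) : Matrix (Fin N) (Fin N) ℝ :=
  Matrix.diagonal (fun i => ∑ j, G.weight i j) - G.weight

end WeightedGraph

/-! ### Cost functions and the optimization problem -/

/-- `f` is differentiable, `ω`-strongly convex (through its gradient), and its gradient is
`θ`-Lipschitz. -/
structure IsStronglyConvexSmooth {m : ℕ} (ω θ : ℝ) (f : Vec m → ℝ) : Prop where
  differentiable : Differentiable ℝ f
  strongly_convex : ∀ a b : Vec m,
    ω * ‖a - b‖ ^ 2 ≤ inner ℝ (gradient f a - gradient f b) (a - b)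
  lipschitz : ∀ a b : Vec m, ‖gradient f a - gradient f b‖ ≤ θ * ‖a - b‖

/-- `y` minimizes the global cost `∑ i, f i` over the whole space. -/
def IsOptimalSolution {N m : ℕ} (f : Fin N → Vec m → ℝ) (y : Vec m) : Prop :=
  IsMinOn (fun w => ∑ i, f i w) Set.univ y

/-! ### Agents, control law and closed loop -/

/-- The polynomial `c 0 + c 1 * s + ... + c (n-1) * s ^ (n-1) + s ^ n`. -/
def feedbackPolynomial {n : ℕ} (c : Fin n → ℝ) : Polynomial ℝ :=
  (∑ k : Fin n, Polynomial.C (c k) * Polynomial.X ^ (k : ℕ)) + Polynomial.X ^ n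

/-- All complex roots lie in the open left half plane. -/
def IsHurwitz (p : Polynomial ℝ) : Prop :=
  ∀ s : ℂ, Polynomial.aeval s p = 0 → s.re < 0

/-- The `n`-th order integrator on `[0, ∞)` with input `v`, in state form: `x t k` is the `k`-th
time derivative of `x t 0`, and the `n`-th derivative equals the input. -/
def IsIntegratorTrajectory {n m : ℕ} (x : ℝ → Fin n → Vec m) (v : ℝ → Vec m) : Prop :=
  ∀ t : ℝ, 0 ≤ t → ∀ k : Fin n,
    HasDerivWithinAt (fun s => x s k)
      (if h : (k : ℕ) + 1 < n then x t ⟨(k : ℕ) + 1, h⟩ else v t) (Set.Ici 0) t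

/-- The output `y = x` of an integrator agent with state `(x, x', ..., x^(n-1))`. -/
def output {n m : ℕ} [NeZero n] (x : Fin n → Vec m) : Vec m := x 0

/-- The high-gain tracking input
`-(1 / ε ^ n) * (c 0 * (x - z) + ∑ k = 1, ..., n - 1, ε ^ k * c k * x^(k))`. -/
def trackingInput {n m : ℕ} [NeZero n] (ε : ℝ) (c : Fin n → ℝ) (x : Fin n → Vec m)
    (z : Vec m) : Vec m :=
  -((1 / ε ^ n) • (c 0 • (x 0 - z) +
    ∑ k ∈ Finset.univ.erase (0 : Fin n), (ε ^ (k : ℕ) * c k) • x k))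

/-- A trajectory on `[0, ∞)` of the agents in closed loop with the tracking law and the optimal
signal generator that uses the real-time gradients at the outputs. -/
structure IsClosedLoopTrajectory {N n m : ℕ} [NeZero n] (G : WeightedGraph N)
    (f : Fin N → Vec m → ℝ) (c : Fin n → ℝ) (ε : ℝ)
    (x : ℝ → Fin N → Fin n → Vec m) (z lam : ℝ → Fin N → Vec m) : Prop where
  agent : ∀ i, IsIntegratorTrajectory (fun t => x t i)
    (fun t => trackingInput ε c (x t i) (z t i))
  generator : ∀ t : ℝ, 0 ≤ t → ∀ i, HasDerivWithinAt (fun s => z s i)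
    (-gradient (f i) (output (x t i)) - ∑ j, G.weight i j • (lam t i - lam t j)) (Set.Ici 0) t
  multiplier : ∀ t : ℝ, 0 ≤ t → ∀ i, HasDerivWithinAt (fun s => lam s i)
    (∑ j, G.weight i j • (z t i - z t j)) (Set.Ici 0) t

/-- From every initial state the closed loop has a trajectory on `[0, ∞)`. -/
def ClosedLoopWellPosed {N n m : ℕ} [NeZero n] (G : WeightedGraph N)
    (f : Fin N → Vec m → ℝ) (c : Fin n → ℝ) (ε : ℝ) : Prop :=
  ∀ (x₀ : Fin N → Fin n → Vec m) (z₀ lam₀ : Fin N → Vec m),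
    ∃ (x : ℝ → Fin N → Fin n → Vec m) (z lam : ℝ → Fin N → Vec m),
      IsClosedLoopTrajectory G f c ε x z lam ∧ x 0 = x₀ ∧ z 0 = z₀ ∧ lam 0 = lam₀

/-- The optimal output consensus problem is solved: the closed loop is well posed, all of its
trajectories are bounded, and all outputs converge to `ystar`. -/
def SolvesOptimalOutputConsensus {N n m : ℕ} [NeZero n] (G : WeightedGraph N)
    (f : Fin N → Vec m → ℝ) (c : Fin n → ℝ) (ε : ℝ) (ystar : Vec m) : Prop :=
  ClosedLoopWellPosed G f c ε ∧
  ∀ (x : ℝ → Fin N → Fin n → Vec m) (z lam : ℝ → Fin N → Vec m),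
    IsClosedLoopTrajectory G f c ε x z lam →
      (∃ B : ℝ, ∀ t : ℝ, 0 ≤ t → ∀ i,
        (∀ k, ‖x t i k‖ ≤ B) ∧ ‖z t i‖ ≤ B ∧ ‖lam t i‖ ≤ B) ∧
      ∀ i, Filter.Tendsto (fun t => ‖output (x t i) - ystar‖) Filter.atTop (nhds 0)

/-- The outputs converge to `ystar` exponentially, with a rate common to all trajectories. -/
def OutputsConvergeExponentially {N n m : ℕ} [NeZero n] (G : WeightedGraph N)
    (f : Fin N → Vec m → ℝ) (c : Fin n → ℝ) (ε : ℝ) (ystar : Vec m) : Prop :=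
  ∃ α : ℝ, 0 < α ∧
    ∀ (x : ℝ → Fin N → Fin n → Vec m) (z lam : ℝ → Fin N → Vec m),
      IsClosedLoopTrajectory G f c ε x z lam →
        ∃ C : ℝ, ∀ t : ℝ, 0 ≤ t → ∀ i,
          ‖output (x t i) - ystar‖ ≤ C * Real.exp (-α * t)

/-! ### The explicit bound on the gain parameter -/

/-- Stacked vectors `col(v_1, ..., v_p)` with the Euclidean norm. -/
abbrev Stacked (p m : ℕ) : Type := PiLp 2 (fun _ : Fin p => Vec m)

/-- Pairs `col(z, μ)` of the generator errors: `z` stacks `N` blocks and `μ` stacks `N - 1`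
blocks; Euclidean norm. -/
abbrev GeneratorError (N m : ℕ) : Type := WithLp 2 (Stacked N m × Stacked (N - 1) m)

/-- Tracking errors: `N` agents with `n` blocks each; Euclidean norm. -/
abbrev TrackingError (N n m : ℕ) : Type := PiLp 2 (fun _ : Fin N => Stacked n m)

/-- The action of `M ⊗ I_m` on stacked vectors. -/
def kronAct {p q m : ℕ} (M : Matrix (Fin p) (Fin q) ℝ) (v : Stacked q m) : Stacked p m :=
  WithLp.toLp 2 (fun i => ∑ j, M i j • v j)

/-- `r_N = (1 / √N) 1_N`. -/
def unitOnes (N : ℕ) : Fin N → ℝ := fun _ => 1 / Real.sqrt N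

/-- `R` completes `r_N` to an orthogonal matrix. -/
structure IsOrthogonalComplement {N : ℕ} (R : Matrix (Fin N) (Fin (N - 1)) ℝ) : Prop where
  mul_unit : R.transpose.mulVec (unitOnes N) = 0
  transpose_mul : R.transpose * R = 1
  mul_transpose : R * R.transpose = 1 - Matrix.vecMulVec (unitOnes N) (unitOnes N)

/-- The unperturbed generator in error coordinates,
`z' = -h - (L R ⊗ I) μ`, `μ' = (Rᵀ L ⊗ I) z` with `h_i = ∇ f_i (ystar + z_i) - ∇ f_i ystar`. -/
def nominalField {N m : ℕ} (G : WeightedGraph N) (f : Fin N → Vec m → ℝ) (ystar : Vec m)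
    (R : Matrix (Fin N) (Fin (N - 1)) ℝ) (e : GeneratorError N m) : GeneratorError N m :=
  WithLp.toLp 2
    (-(WithLp.toLp 2 (fun i => gradient (f i) (ystar + e.fst i) - gradient (f i) ystar))
        - kronAct (G.laplacian * R) e.snd,
      kronAct (R.transpose * G.laplacian) e.fst)

/-- The perturbed right-hand side `-h - Δ - (L R ⊗ I) μ`, where
`Δ_i = ∇ f_i (y_i) - ∇ f_i (z_i)`, `z_i = ystar + e.fst i` and `y_i = z_i + ξ i 0`. -/
def coupling {N n m : ℕ} [NeZero n] (G : WeightedGraph N) (f : Fin N → Vec m → ℝ)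
    (ystar : Vec m) (R : Matrix (Fin N) (Fin (N - 1)) ℝ) (ξ : TrackingError N n m)
    (e : GeneratorError N m) : Stacked N m :=
  -(WithLp.toLp 2 (fun i => gradient (f i) (ystar + e.fst i) - gradient (f i) ystar))
    - WithLp.toLp 2 (fun i => gradient (f i) (ystar + e.fst i + ξ i 0)
        - gradient (f i) (ystar + e.fst i))
    - kronAct (G.laplacian * R) e.snd

/-- The companion matrix: shift in the first `n - 1` rows, last row `(-c 0, ..., -c (n-1))`. -/
def companion {n : ℕ} (c : Fin n → ℝ) : Matrix (Fin n) (Fin n) ℝ :=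
  fun i j => if (i : ℕ) + 1 = n then -c j else if (j : ℕ) = (i : ℕ) + 1 then 1 else 0

/-- `A_m = A ⊗ I_m` for the companion matrix `A`. -/
def blockCompanion {n : ℕ} (c : Fin n → ℝ) (m : ℕ) :
    Matrix (Fin n × Fin m) (Fin n × Fin m) ℝ :=
  companion c ⊗ₖ (1 : Matrix (Fin m) (Fin m) ℝ)

/-- `b_m = col(-1, 0, ..., 0) ⊗ I_m`. -/
def blockInput (n m : ℕ) [NeZero n] : Matrix (Fin n × Fin m) (Fin m) ℝ :=
  fun p l => if p.1 = 0 ∧ p.2 = l then -1 else 0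

/-- The norm of a real matrix as an operator between Euclidean spaces. -/
def euclideanOpNorm {ι κ : Type} [Fintype ι] [Fintype κ] [DecidableEq κ] (M : Matrix ι κ ℝ) : ℝ :=
  ‖(Matrix.toEuclideanLin M).toContinuousLinearMap‖

/-- The data entering the explicit bound on `ε`: an orthogonal complement `R`, the solution `P` of
the Lyapunov equation, a Lyapunov function `V` for the unperturbed generator with its constants,
and constants bounding the coupling term. -/
structure GainData {N n m : ℕ} [NeZero n] (G : WeightedGraph N) (f : Fin N → Vec m → ℝ)
    (c : Fin n → ℝ) (ystar : Vec m) where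
  R : Matrix (Fin N) (Fin (N - 1)) ℝ
  isOrthogonalComplement : IsOrthogonalComplement R
  P : Matrix (Fin n × Fin m) (Fin n × Fin m) ℝ
  posDef : P.PosDef
  lyapunov : (blockCompanion c m).transpose * P + P * blockCompanion c m = -1
  V : GeneratorError N m → ℝ
  contDiff : ContDiff ℝ 1 V
  c₁ : ℝ
  c₂ : ℝ
  c₃ : ℝ
  c₄ : ℝ
  c₁_pos : 0 < c₁
  c₂_pos : 0 < c₂
  c₃_pos : 0 < c₃
  c₄_pos : 0 < c₄
  lower : ∀ e, c₁ * ‖e‖ ^ 2 ≤ V e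
  upper : ∀ e, V e ≤ c₂ * ‖e‖ ^ 2
  decay : ∀ e, fderiv ℝ V e (nominalField G f ystar R e) ≤ -c₃ * ‖e‖ ^ 2
  deriv_bound : ∀ e, ‖fderiv ℝ V e‖ ≤ c₄ * ‖e‖
  κ₂ : ℝ
  κ₃ : ℝ
  κ₂_pos : 0 < κ₂
  κ₃_pos : 0 < κ₃
  coupling_bound : ∀ (ξ : TrackingError N n m) (e : GeneratorError N m),
    ‖coupling G f ystar R ξ e‖ ≤ κ₂ * ‖ξ‖ + κ₃ * ‖e‖

namespace GainData

variable {N n m : ℕ} [NeZero n] {G : WeightedGraph N} {f : Fin N → Vec m → ℝ}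
  {c : Fin n → ℝ} {ystar : Vec m}

/-- `‖I_N ⊗ P b_m‖`. -/
def inputGain (D : GainData G f c ystar) : ℝ :=
  euclideanOpNorm ((1 : Matrix (Fin N) (Fin N) ℝ) ⊗ₖ (D.P * blockInput n m))

/-- `2 κ₂ ‖I_N ⊗ P b_m‖`. -/
def theta₂ (D : GainData G f c ystar) : ℝ := 2 * D.κ₂ * D.inputGain

/-- `2 κ₃ ‖I_N ⊗ P b_m‖`. -/
def theta₃ (D : GainData G f c ystar) : ℝ := 2 * D.κ₃ * D.inputGain

/-- `theta₃ + c₄ θ`, where `θ` is the Lipschitz constant of the gradients. -/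
def theta₄ (D : GainData G f c ystar) (θ : ℝ) : ℝ := D.theta₃ + D.c₄ * θ

/-- The explicit bound `ε* = 2 c₃ / (2 c₃ theta₂ + theta₄ ^ 2)`. -/
def epsStar (D : GainData G f c ystar) (θ : ℝ) : ℝ :=
  2 * D.c₃ / (2 * D.c₃ * D.theta₂ + D.theta₄ θ ^ 2)

end GainData

end OptimalConsensus

end

open OptimalConsensus

/-! ### Strongly monotone maps and minimizers -/

/-! The closed loop couples a fast tracking subsystem to a slower saddle-point flow, and a composite
Lyapunov function settles it.

Let `ystar` be the zero of `∑ i, gradient (f i)`. These gradients sum to zero at `ystar`, so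
connectedness gives a multiplier `lamstar` with `L lamstar = -(gradient (f i) ystar)_i`. Centre `z`
at `ystar` and `lam` at `lamstar`, and keep only `μ = Rᵀ (lam - lamstar)`. This discards the average
of the multipliers, which is conserved. With outputs replaced by generator states, the errors `(z,
μ)` follow `z' = -h - L R μ`, `μ' = Rᵀ L z`. Here `h` is strongly monotone and `L R` is injective,
so a weighted squared norm plus the cross term `⟪z, L R μ⟫` is a strict Lyapunov function
(`exists_saddle_lyapunov`).

The scaled tracking errors `ξ = (x - z, ε x', ..., ε ^ (n-1) x^(n-1))` satisfy `ξ' = ε⁻¹ A ξ + b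
z'`, with `A` the companion matrix. A Hurwitz `A` admits a solution `P` of the Lyapunov equation,
obtained by a Cayley transform from the discrete equation, which is solved by a convergent series.

For any choice of gain data, the derivative of `V(e) + ξᵀ (I ⊗ P) ξ` is at most `-(ε⁻¹ - theta₂)
‖ξ‖² - c₃ ‖e‖² + theta₄ ‖ξ‖ ‖e‖`. This is negative definite when `ε < epsStar`
(`GainData.theta₄_sq_lt`). Both errors then decay exponentially, and `y_i - ystar = ξ_{i,0} + (z_i -
ystar)` passes the decay on to the outputs. Boundedness of `lam` also uses the conserved average.
Existence of trajectories follows from the global Lipschitz continuity of the vector field. -/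

/-- A strongly monotone Lipschitz map of a Hilbert space has a zero. -/
theorem exists_zero_of_strongly_monotone {E : Type*} [NormedAddCommGroup E]
    [InnerProductSpace ℝ E] [CompleteSpace E] (g : E → E) {ω θ : ℝ} (hω : 0 < ω) (hθ : 0 < θ)
    (hmono : ∀ a b, ω * ‖a - b‖ ^ 2 ≤ inner ℝ (g a - g b) (a - b))
    (hlip : ∀ a b, ‖g a - g b‖ ≤ θ * ‖a - b‖) : ∃ y, g y = 0 := by
  -- This step size minimizes the squared contraction factor `1 - 2 η ω + η² θ²` of `x ↦ x - η • g
  -- x`; the minimum is `1 - ω² / θ²`.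
  set η : ℝ := ω / θ ^ 2 with hη
  have hηpos : 0 < η := by positivity
  set q : ℝ := Real.sqrt (1 - ω ^ 2 / θ ^ 2) with hq
  have hq1 : q < 1 := by
    rw [hq, Real.sqrt_lt' one_pos]
    have : 0 < ω ^ 2 / θ ^ 2 := by positivity
    linarith
  have hcontr : ContractingWith ⟨q, Real.sqrt_nonneg _⟩ (fun x => x - η • g x) := by
    refine ⟨by exact_mod_cast hq1, LipschitzWith.of_dist_le_mul fun a b => ?_⟩
    rw [dist_eq_norm, dist_eq_norm]
    have hsq : ‖(a - η • g a) - (b - η • g b)‖ ^ 2 ≤ (1 - ω ^ 2 / θ ^ 2) * ‖a - b‖ ^ 2 := by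
      have e : (a - η • g a) - (b - η • g b) = (a - b) - η • (g a - g b) := by
        rw [smul_sub]; abel
      rw [e, norm_sub_sq_real, inner_smul_right, norm_smul, mul_pow, Real.norm_eq_abs, sq_abs,
        real_inner_comm]
      have h1 := hmono a b
      have h2 : ‖g a - g b‖ ^ 2 ≤ θ ^ 2 * ‖a - b‖ ^ 2 := by
        rw [← mul_pow]; exact pow_le_pow_left₀ (norm_nonneg _) (hlip a b) 2
      have h3 : η ^ 2 * ‖g a - g b‖ ^ 2 ≤ ω ^ 2 / θ ^ 2 * ‖a - b‖ ^ 2 := by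
        calc _ ≤ η ^ 2 * (θ ^ 2 * ‖a - b‖ ^ 2) := by gcongr
          _ = _ := by rw [hη]; field_simp
      have h4 : ω ^ 2 / θ ^ 2 * ‖a - b‖ ^ 2 ≤ η * inner ℝ (g a - g b) (a - b) := by
        calc _ = η * (ω * ‖a - b‖ ^ 2) := by rw [hη]; field_simp
          _ ≤ _ := by gcongr
      linarith
    change _ ≤ q * _
    by_cases hs : 0 ≤ 1 - ω ^ 2 / θ ^ 2
    · refine abs_le_of_sq_le_sq' ?_ (by positivity) |>.2
      rwa [mul_pow, hq, Real.sq_sqrt hs]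
    -- If `ω > θ`, the two hypotheses force the space to be trivial. The square root is then `0` by
    -- convention, and all images coincide.
    · have h0 : ‖(a - η • g a) - (b - η • g b)‖ ^ 2 ≤ 0 :=
        hsq.trans (mul_nonpos_of_nonpos_of_nonneg (by linarith) (by positivity))
      have : ‖(a - η • g a) - (b - η • g b)‖ = 0 := by
        exact pow_eq_zero_iff two_ne_zero |>.1 (le_antisymm h0 (by positivity))
      rw [this]; positivity
  have : Nonempty E := ⟨0⟩
  refine ⟨hcontr.fixedPoint, ?_⟩
  have h := hcontr.fixedPoint_isFixedPt
  simp only [Function.IsFixedPt, sub_eq_self, smul_eq_zero, hηpos.ne', false_or] at h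
  exact h

/-- A critical point of a function with monotone gradient is a global minimizer. -/
theorem isMinOn_of_monotone_gradient {E : Type*} [NormedAddCommGroup E]
    [InnerProductSpace ℝ E] [CompleteSpace E] {F : E → ℝ} {g : E → E}
    (hF : ∀ x, HasGradientAt F (g x) x) (hmono : ∀ a b, 0 ≤ inner ℝ (g a - g b) (a - b))
    {y : E} (hy : g y = 0) : IsMinOn F Set.univ y := by
  intro w _
  have hd : ∀ s : ℝ, HasDerivAt (fun s : ℝ => F (y + s • (w - y)))
      (inner ℝ (g (y + s • (w - y))) (w - y)) s := by
    intro s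
    have h1 : HasDerivAt (fun s : ℝ => y + s • (w - y)) (w - y) s := by
      simpa using ((hasDerivAt_id s).smul_const (w - y)).const_add y
    have h2 := (hF (y + s • (w - y))).hasFDerivAt.comp_hasDerivAt s h1
    simpa [Function.comp_def] using! h2
  have hm : MonotoneOn (fun s : ℝ => F (y + s • (w - y))) (Set.Icc 0 1) := by
    refine monotoneOn_of_deriv_nonneg (convex_Icc 0 1)
      (fun s _ => (hd s).continuousAt.continuousWithinAt)
      (fun s _ => (hd s).differentiableAt.differentiableWithinAt) ?_
    intro s hs
    rw [interior_Icc] at hs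
    rw [(hd s).deriv]
    -- Since `g y = 0`, monotonicity against `y` yields `s` times the derivative along the segment,
    -- and `s > 0` can be divided out.
    have h := hmono (y + s • (w - y)) y
    rw [hy, sub_zero, add_sub_cancel_left, inner_smul_right] at h
    exact nonneg_of_mul_nonneg_right h hs.1
  have := hm (Set.left_mem_Icc.2 zero_le_one) (Set.right_mem_Icc.2 zero_le_one) zero_le_one
  simpa using this

namespace OptimalConsensus

theorem IsStronglyConvexSmooth.hasGradientAt_sum {N m : ℕ} {f : Fin N → Vec m → ℝ} {ω θ : ℝ}
    (hf : ∀ i, IsStronglyConvexSmooth ω θ (f i)) (x : Vec m) :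
    HasGradientAt (fun w => ∑ i, f i w) (∑ i, gradient (f i) x) x := by
  rw [hasGradientAt_iff_hasFDerivAt, map_sum]
  exact HasFDerivAt.fun_sum fun i _ => ((hf i).differentiable x).hasGradientAt.hasFDerivAt

/-- The summed gradient is strongly monotone with constant `N ω` and Lipschitz with constant `N θ`,
hence has a zero, which monotonicity makes a global minimizer. Any other minimizer is also a zero,
and strong monotonicity allows only one. The vanishing gradient sum is recorded because the optimal
multiplier is built from it. -/
theorem exists_unique_optimal {N m : ℕ} (hN : 0 < N) {f : Fin N → Vec m → ℝ} {ω θ : ℝ}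
    (hω : 0 < ω) (hθ : 0 < θ) (hf : ∀ i, IsStronglyConvexSmooth ω θ (f i)) :
    ∃ ystar : Vec m, (∑ i, gradient (f i) ystar = 0) ∧ IsOptimalSolution f ystar ∧
      ∀ y, IsOptimalSolution f y → y = ystar := by
  have hN' : (0 : ℝ) < N := by exact_mod_cast hN
  have hmono : ∀ a b : Vec m, (N * ω) * ‖a - b‖ ^ 2 ≤
      inner ℝ (∑ i, gradient (f i) a - ∑ i, gradient (f i) b) (a - b) := by
    intro a b
    rw [← Finset.sum_sub_distrib, sum_inner]
    calc _ = ∑ _i : Fin N, ω * ‖a - b‖ ^ 2 := by simp [mul_assoc]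
      _ ≤ _ := Finset.sum_le_sum fun i _ => (hf i).strongly_convex a b
  have hlip : ∀ a b : Vec m, ‖∑ i, gradient (f i) a - ∑ i, gradient (f i) b‖ ≤
      (N * θ) * ‖a - b‖ := by
    intro a b
    rw [← Finset.sum_sub_distrib]
    calc _ ≤ ∑ _i : Fin N, θ * ‖a - b‖ := norm_sum_le_of_le _ fun i _ => (hf i).lipschitz a b
      _ = _ := by simp [mul_assoc]
  obtain ⟨y, hy⟩ := exists_zero_of_strongly_monotone _ (by positivity) (by positivity) hmono hlip
  refine ⟨y, hy, ?_, fun w hw => ?_⟩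
  · exact isMinOn_of_monotone_gradient (IsStronglyConvexSmooth.hasGradientAt_sum hf)
      (fun a b => le_trans (by positivity) (hmono a b)) hy
  · have hloc : IsLocalMin (fun v => ∑ i, f i v) w := hw.isLocalMin Filter.univ_mem
    have h0 := hloc.hasFDerivAt_eq_zero
      (IsStronglyConvexSmooth.hasGradientAt_sum hf w).hasFDerivAt
    have h1 : ∑ i, gradient (f i) w = 0 :=
      (InnerProductSpace.toDual ℝ (Vec m)).map_eq_zero_iff.1 h0
    have h2 := hmono w y
    rw [h1, hy, sub_zero, inner_zero_left] at h2
    have h3 : ‖w - y‖ ^ 2 ≤ 0 := nonpos_of_mul_nonpos_right h2 (by positivity)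
    have : ‖w - y‖ = 0 := pow_eq_zero_iff two_ne_zero |>.1 (le_antisymm h3 (by positivity))
    exact sub_eq_zero.1 (norm_eq_zero.1 this)

end OptimalConsensus

/-! ### Global solutions of Lipschitz differential equations -/

/-- Solutions of an autonomous equation with Lipschitz right-hand side exist on an interval whose
length does not depend on the initial value. -/
theorem LipschitzWith.exists_uniform_solution {E : Type*} [NormedAddCommGroup E] [NormedSpace ℝ E]
    [CompleteSpace E] {F : E → E} {K : NNReal} (hF : LipschitzWith K F) :
    ∃ T : ℝ, 0 < T ∧ ∀ x₀ : E, ∃ γ : ℝ → E, γ 0 = x₀ ∧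
      ∀ t ∈ Set.Icc 0 T, HasDerivWithinAt γ (F (γ t)) (Set.Icc 0 T) t := by
  -- On the ball of radius `‖F x₀‖ + 1` about `x₀` the speed is at most `(K + 1) (‖F x₀‖ + 1)`. The
  -- quotient of radius by speed is at least `1 / (K + 1)`, whatever `x₀` is.
  have hT : (0 : ℝ) < 1 / (2 * (K + 1)) := by positivity
  refine ⟨1 / (2 * (K + 1)), hT, fun x₀ => ?_⟩
  have hpl : IsPicardLindelof (fun _ => F) (tmin := 0) (tmax := 1 / (2 * ((K : ℝ) + 1)))
      ⟨0, Set.left_mem_Icc.2 hT.le⟩ x₀ (‖F x₀‖₊ + 1) 0 (‖F x₀‖₊ + K * (‖F x₀‖₊ + 1)) K := by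
    refine ⟨fun t _ => hF.lipschitzOnWith, fun x _ => continuousOn_const, fun t _ x hx => ?_, ?_⟩
    · have h1 := hF.dist_le_mul x x₀
      have h2 : dist x x₀ ≤ ‖F x₀‖ + 1 := by simpa using hx
      rw [dist_eq_norm] at h1
      push_cast
      have h3 : (K : ℝ) * dist x x₀ ≤ K * (‖F x₀‖ + 1) := by gcongr
      have h4 := norm_le_insert' (F x) (F x₀)
      linarith
    · have hK : (0 : ℝ) ≤ K := K.2
      push_cast
      simp only [sub_zero, sub_self]
      rw [max_eq_left hT.le, mul_one_div, div_le_iff₀ (by positivity)]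
      nlinarith [norm_nonneg (F x₀), mul_nonneg hK (norm_nonneg (F x₀))]
  exact hpl.exists_eq_forall_mem_Icc_hasDerivWithinAt₀

/-- An autonomous equation with Lipschitz right-hand side has solutions on `[0, ∞)`. -/
theorem LipschitzWith.exists_global_solution {E : Type*} [NormedAddCommGroup E] [NormedSpace ℝ E]
    [CompleteSpace E] {F : E → E} {K : NNReal} (hF : LipschitzWith K F) (x₀ : E) :
    ∃ γ : ℝ → E, γ 0 = x₀ ∧
      ∀ t, 0 ≤ t → HasDerivWithinAt γ (F (γ t)) (Set.Ici 0) t := by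
  obtain ⟨T, hT, hsol⟩ := hF.exists_uniform_solution
  choose φ hφ0 hφ using hsol
  -- The `p k` are the values at the times `k T`; local solutions of the common length `T` are glued
  -- there.
  let p : ℕ → E := fun k => Nat.rec x₀ (fun _ x => φ x T) k
  have hp : ∀ k, p (k + 1) = φ (p k) T := fun k => rfl
  let γ : ℝ → E := fun t => φ (p ⌊t / T⌋₊) (t - ⌊t / T⌋₊ * T)
  have hγ : ∀ k : ℕ, ∀ t ∈ Set.Icc (k * T) ((k + 1) * T), γ t = φ (p k) (t - k * T) := by
    intro k t ht
    rcases ht.2.lt_or_eq with h | h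
    · have : ⌊t / T⌋₊ = k := by
        rw [Nat.floor_eq_iff (div_nonneg (le_trans (by positivity) ht.1) hT.le)]
        exact ⟨(le_div_iff₀ hT).2 ht.1, (div_lt_iff₀ hT).2 h⟩
      simp only [γ, this]
    -- At the right endpoint the floor already selects the next piece, whose initial value is the
    -- end value of this one.
    · have : ⌊t / T⌋₊ = k + 1 := by
        rw [h, mul_div_cancel_right₀ _ hT.ne']
        exact_mod_cast Nat.floor_natCast (k + 1)
      simp only [γ, this]
      rw [h, hp]
      push_cast
      rw [sub_self, hφ0]
      congr 1; ring
  have hder : ∀ k : ℕ, ∀ t ∈ Set.Icc (k * T) ((k + 1) * T),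
      HasDerivWithinAt γ (F (γ t)) (Set.Icc (k * T) ((k + 1) * T)) t := by
    intro k t ht
    have hmaps : Set.MapsTo (fun s : ℝ => s - k * T) (Set.Icc (k * T) ((k + 1) * T))
        (Set.Icc 0 T) := fun s hs => ⟨by linarith [hs.1], by linarith [hs.2]⟩
    have h1 : HasDerivWithinAt (fun s : ℝ => s - k * T) 1 (Set.Icc (k * T) ((k + 1) * T)) t :=
      (hasDerivWithinAt_id t _).sub_const _
    have h2 := (hφ (p k) (t - k * T) (hmaps ht)).scomp t h1 hmaps
    rw [one_smul, ← hγ k t ht] at h2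
    exact h2.congr (fun s hs => hγ k s hs) (hγ k t ht)
  refine ⟨γ, ?_, fun t ht => ?_⟩
  · have := hγ 0 0 (by simp [hT.le])
    rw [this, Nat.cast_zero, zero_mul, sub_zero, hφ0]
    rfl
  · set k := ⌊t / T⌋₊ with hk
    have hk1 : k * T ≤ t := (le_div_iff₀ hT).1 (Nat.floor_le (div_nonneg ht hT.le))
    have hk2 : t < (k + 1) * T := (div_lt_iff₀ hT).1 (Nat.lt_floor_add_one (t / T))
    rcases hk1.lt_or_eq with h | h
    · exact ((hder k t ⟨hk1, hk2.le⟩).hasDerivAt (Icc_mem_nhds h hk2)).hasDerivWithinAt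
    -- At a junction `k T` with `k > 0`, the one-sided derivatives from the two adjacent pieces
    -- agree and combine; at time `0` only the right-hand one is needed.
    · rcases Nat.eq_zero_or_pos k with h0 | h0
      · have h3 := hder k t ⟨hk1, hk2.le⟩
        rw [h0] at h3 hk2 h
        simp only [Nat.cast_zero, zero_mul, zero_add, one_mul] at h3 hk2 h
        refine h3.mono_of_mem_nhdsWithin ?_
        rw [← h]
        exact Icc_mem_nhdsGE hT
      · obtain ⟨j, hj⟩ := Nat.exists_eq_succ_of_ne_zero h0.ne'
        have hjk : ((j : ℝ) + 1) = k := by rw [hj]; push_cast; ring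
        have h3 := hder j t ⟨by rw [← h, ← hjk]; nlinarith, by rw [hjk, h]⟩
        have h4 := hder k t ⟨hk1, hk2.le⟩
        have h5 := h3.union h4
        rw [hjk, Set.Icc_union_Icc_eq_Icc (by rw [← hjk]; nlinarith) (by nlinarith)] at h5
        exact (h5.hasDerivAt (Icc_mem_nhds (by rw [← h, ← hjk]; nlinarith) hk2)).hasDerivWithinAt

/-! ### The Lyapunov equation of a Hurwitz matrix -/

namespace Matrix

section

attribute [local instance] Matrix.linftyOpNormedRing Matrix.linftyOpNormedAlgebra

/-- The entries of the powers of a complex matrix with spectral radius less than one decay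
geometrically. -/
theorem exists_entry_pow_le_of_spectrum {ι : Type*} [Fintype ι] [DecidableEq ι] [Nonempty ι]
    (B : Matrix ι ι ℂ) (hB : ∀ μ ∈ spectrum ℂ B, ‖μ‖ < 1) :
    ∃ r : ℝ, 0 ≤ r ∧ r < 1 ∧ ∀ᶠ k : ℕ in Filter.atTop, ∀ i j, ‖(B ^ k) i j‖ ≤ r ^ k := by
  have h1 : spectralRadius ℂ B < (1 : NNReal) :=
    spectrum.spectralRadius_lt_of_forall_lt B fun μ hμ => by exact_mod_cast hB μ hμ
  obtain ⟨r, hr1, hr2⟩ := ENNReal.lt_iff_exists_nnreal_btwn.1 h1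
  refine ⟨r, r.2, by exact_mod_cast hr2, ?_⟩
  -- Gelfand's formula puts `‖B ^ k‖ ^ (1 / k)` eventually below `r`, and the row-sum norm dominates
  -- every entry.
  filter_upwards [(spectrum.pow_nnnorm_pow_one_div_tendsto_nhds_spectralRadius B).eventually
    (gt_mem_nhds hr1), Filter.eventually_gt_atTop 0] with k hk hk0 i j
  have hk0' : (0 : ℝ) < k := by exact_mod_cast hk0
  have h2 : ‖B ^ k‖₊ ≤ r ^ k := by
    rw [one_div] at hk
    have h3 := (ENNReal.rpow_inv_le_iff hk0').1 hk.le
    rw [ENNReal.rpow_natCast] at h3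
    exact_mod_cast h3
  have h4 : ‖(B ^ k) i j‖₊ ≤ ‖B ^ k‖₊ := by
    rw [Matrix.linfty_opNNNorm_def]
    exact (Finset.single_le_sum (f := fun j => ‖(B ^ k) i j‖₊) (fun _ _ => zero_le)
      (Finset.mem_univ j)).trans
      (Finset.le_sup (f := fun i => ∑ j, ‖(B ^ k) i j‖₊) (Finset.mem_univ i))
  exact_mod_cast h4.trans h2

end

/-- The discrete Lyapunov equation of a Schur stable matrix is solvable. -/
theorem exists_posDef_discrete_lyapunov {ι : Type*} [Fintype ι] [DecidableEq ι] [Nonempty ι]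
    (B Q : Matrix ι ι ℝ) (hB : ∀ μ ∈ spectrum ℂ (B.map Complex.ofRealHom), ‖μ‖ < 1)
    (hQ : Q.PosDef) : ∃ P : Matrix ι ι ℝ, P.PosDef ∧ Bᵀ * P * B = P - Q := by
  obtain ⟨r, hr0, hr1, hr⟩ := exists_entry_pow_le_of_spectrum _ hB
  have hent : ∀ᶠ k : ℕ in Filter.atTop, ∀ i j, ‖(B ^ k) i j‖ ≤ r ^ k := by
    filter_upwards [hr] with k hk i j
    have := hk i j
    rw [← Matrix.map_pow] at this
    simpa using this
  -- The solution is `P = ∑ k, (B ^ k)ᵀ Q B ^ k`; its entries are dominated by a geometric series of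
  -- ratio `r²`.
  have hsum : Summable fun k => (B ^ k)ᵀ * Q * B ^ k := by
    refine Pi.summable.2 fun i => Pi.summable.2 fun j => ?_
    have : (fun k => ((B ^ k)ᵀ * Q * B ^ k) i j) =
        fun k => ∑ b, ∑ a, (B ^ k) a i * Q a b * (B ^ k) b j := by
      ext k
      simp only [Matrix.mul_apply, Finset.sum_mul, Matrix.transpose_apply]
    refine this ▸ summable_sum fun b _ => summable_sum fun a _ => ?_
    refine Summable.of_norm_bounded_eventually_nat
      (g := fun k => ‖Q a b‖ * (r * r) ^ k) ?_ ?_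
    · exact (summable_geometric_of_lt_one (by positivity) (by nlinarith)).mul_left _
    · filter_upwards [hent] with k hk
      rw [norm_mul, norm_mul, mul_pow]
      calc _ ≤ r ^ k * ‖Q a b‖ * r ^ k := by gcongr <;> exact hk _ _
        _ = _ := by ring
  obtain ⟨P, hP⟩ := hsum
  have hquad : ∀ x : ι → ℝ, HasSum (fun k => (B ^ k *ᵥ x) ⬝ᵥ Q *ᵥ (B ^ k *ᵥ x)) (x ⬝ᵥ P *ᵥ x) := by
    intro x
    have hc : Continuous fun M : Matrix ι ι ℝ => x ⬝ᵥ M *ᵥ x := by fun_prop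
    have h := hP.map (⟨⟨fun M : Matrix ι ι ℝ => x ⬝ᵥ M *ᵥ x, by simp⟩, fun M M' => by
      simp [Matrix.add_mulVec, dotProduct_add]⟩ : Matrix ι ι ℝ →+ ℝ) hc
    convert! h using 2 with k
    simp only [Function.comp, AddMonoidHom.coe_mk, ZeroHom.coe_mk]
    rw [← Matrix.mulVec_mulVec, ← Matrix.mulVec_mulVec, Matrix.dotProduct_mulVec x,
      Matrix.vecMul_transpose]
  refine ⟨P, PosDef.of_dotProduct_mulVec_pos ?_ fun x hx => ?_, ?_⟩
  · rw [IsHermitian, conjTranspose_eq_transpose_of_trivial]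
    have h := hP.matrix_transpose
    refine h.unique ?_
    convert hP using 2 with k
    have hQt : Qᵀ = Q := by simpa [IsHermitian] using hQ.isHermitian
    simp [Matrix.transpose_mul, hQt, Matrix.mul_assoc]
  -- The `k = 0` term `xᵀ Q x` is positive and the remaining terms are nonnegative.
  · have h := sum_le_hasSum {0} (fun k _ => ?_) (hquad x)
    · have h0 := hQ.dotProduct_mulVec_pos hx
      simp only [Finset.sum_singleton, pow_zero, one_mulVec] at h
      simp only [star_trivial] at h0 ⊢
      exact h0.trans_le h
    · simpa using hQ.posSemidef.dotProduct_mulVec_nonneg (B ^ k *ᵥ x)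
  -- Conjugation by `B` shifts the series by one index, so it removes exactly the term `Q`.
  · have h1 : HasSum (fun k => (B ^ (k + 1))ᵀ * Q * B ^ (k + 1)) (Bᵀ * P * B) := by
      convert! (hP.mul_left Bᵀ).mul_right B using 2
      funext k
      rw [pow_succ, Matrix.transpose_mul]
      simp only [Matrix.mul_assoc]
    have h2 := (hasSum_nat_add_iff' (f := fun k => (B ^ k)ᵀ * Q * B ^ k) 1).2 hP
    simp only [Finset.range_one, Finset.sum_singleton, pow_zero, transpose_one, one_mul,
      mul_one] at h2
    exact h1.unique h2

/-- The Lyapunov equation of a Hurwitz matrix is solvable. -/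
theorem exists_posDef_lyapunov {ι : Type*} [Fintype ι] [DecidableEq ι] [Nonempty ι]
    (A : Matrix ι ι ℝ)
    (hA : ∀ (s : ℂ) (v : ι → ℂ), v ≠ 0 → A.map Complex.ofRealHom *ᵥ v = s • v → s.re < 0) :
    ∃ P : Matrix ι ι ℝ, P.PosDef ∧ Aᵀ * P + P * A = -1 := by
  have hunit : IsUnit (1 - A) := by
    rw [Matrix.isUnit_iff_isUnit_det, isUnit_iff_ne_zero]
    intro h0
    obtain ⟨v, hv, hv0⟩ := Matrix.exists_mulVec_eq_zero_iff.2 h0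
    rw [Matrix.sub_mulVec, Matrix.one_mulVec, sub_eq_zero] at hv0
    have := hA 1 (fun i => (v i : ℂ)) (fun h => hv (funext fun i => by
      simpa using congrFun h i)) (by
        funext i
        have := congrFun hv0 i
        rw [one_smul, this]
        simp [Matrix.mulVec, dotProduct])
    norm_num at this
  obtain ⟨u, hu⟩ := hunit
  set C : Matrix ι ι ℝ := ↑u⁻¹ with hC
  have hC1 : C * (1 - A) = 1 := by rw [← hu, hC, Units.inv_mul]
  have hC2 : (1 - A) * C = 1 := by rw [← hu, hC, Units.mul_inv]
  -- The discrete equation is applied to the Cayley transform `(1 + A) C` with `C = (1 - A)⁻¹`. This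
  -- `Q` becomes `2 • 1` after conjugation by `1 - A`.
  have hQ : ((2 : ℝ) • (Cᵀ * C)).PosDef := by
    refine PosDef.smul ?_ two_pos
    have := PosDef.conjTranspose_mul_self C (Matrix.mulVec_injective_of_isUnit (u⁻¹).isUnit)
    simpa using this
  have hspec : ∀ μ ∈ spectrum ℂ (((1 + A) * C).map Complex.ofRealHom), ‖μ‖ < 1 := by
    intro μ hμ
    rw [← Matrix.spectrum_toLin', ← Module.End.hasEigenvalue_iff_mem_spectrum] at hμ
    obtain ⟨v, hv⟩ := hμ.exists_hasEigenvector
    have hv1 : ((1 + A) * C).map Complex.ofRealHom *ᵥ v = μ • v := by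
      simpa using hv.apply_eq_smul
    set Ac := A.map Complex.ofRealHom
    set Cc := C.map Complex.ofRealHom with hCc
    have hc2 : (1 - Ac) * Cc = 1 := by
      have := congrArg (fun M : Matrix ι ι ℝ => M.map Complex.ofRealHom) hC2
      simpa [Matrix.map_mul, Ac, Matrix.map_sub, sub_mul] using this
    set w := Cc *ᵥ v
    have hw : v = (1 - Ac) *ᵥ w := by rw [Matrix.mulVec_mulVec, hc2, Matrix.one_mulVec]
    have hw0 : w ≠ 0 := fun h => hv.2 (by rw [hw, h, Matrix.mulVec_zero])
    have hv2 : (1 + Ac) *ᵥ w = μ • ((1 - Ac) *ᵥ w) := by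
      rw [← hw, ← hv1, Matrix.mulVec_mulVec]
      congr 1
      simp [Matrix.map_mul, Ac, Cc, Matrix.map_add, add_mul]
    have hv3 : (μ + 1) • (Ac *ᵥ w) = (μ - 1) • w := by
      rw [Matrix.add_mulVec, Matrix.sub_mulVec, Matrix.one_mulVec, smul_sub] at hv2
      rw [add_smul, sub_smul, one_smul, one_smul, sub_eq_iff_eq_add.2]
      rw [eq_sub_iff_add_eq] at hv2
      rw [← sub_eq_iff_eq_add', ← hv2]
      abel
    have hμ1 : μ + 1 ≠ 0 := by
      intro h
      rw [h, zero_smul] at hv3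
      rcases smul_eq_zero.1 hv3.symm with h' | h'
      · have : (2 : ℂ) = 0 := by linear_combination h - h'
        norm_num at this
      · exact hw0 h'
    -- An eigenvalue `μ` of the Cayley transform comes from the eigenvalue `(μ - 1) / (μ + 1)` of
    -- `A`. That this has negative real part means `‖μ‖² - 1 < 0`, the numerator in `h4`.
    have hre := hA ((μ - 1) / (μ + 1)) w hw0 (by
      rw [div_eq_inv_mul, mul_smul, ← hv3, smul_smul, inv_mul_cancel₀ hμ1, one_smul])
    rw [Complex.div_re, ← add_div, div_neg_iff] at hre
    have hn : 0 < Complex.normSq (μ + 1) := Complex.normSq_pos.2 hμ1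
    have h4 : (μ - 1).re * (μ + 1).re + (μ - 1).im * (μ + 1).im < 0 := by
      rcases hre with h | h
      · exact absurd h.2 hn.not_gt
      · exact h.1
    simp at h4
    rw [← sq_lt_one_iff₀ (norm_nonneg _), ← Complex.normSq_eq_norm_sq, Complex.normSq_apply]
    linarith
  obtain ⟨P, hP, hPe⟩ := exists_posDef_discrete_lyapunov _ _ hspec hQ
  refine ⟨P, hP, ?_⟩
  have h1 : (1 + A)ᵀ * P * (1 + A) = (1 - A)ᵀ * P * (1 - A) - (2 : ℝ) • 1 := by
    have hB : (1 + A) * C * (1 - A) = 1 + A := by rw [Matrix.mul_assoc, hC1, Matrix.mul_one]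
    have hC3 : (1 - A)ᵀ * Cᵀ = 1 := by rw [← Matrix.transpose_mul, hC1, Matrix.transpose_one]
    calc _ = ((1 + A) * C * (1 - A))ᵀ * P * ((1 + A) * C * (1 - A)) := by rw [hB]
      _ = (1 - A)ᵀ * (((1 + A) * C)ᵀ * P * ((1 + A) * C)) * (1 - A) := by
        rw [Matrix.transpose_mul _ (1 - A)]; simp only [Matrix.mul_assoc]
      _ = (1 - A)ᵀ * P * (1 - A) - (1 - A)ᵀ * ((2 : ℝ) • (Cᵀ * C)) * (1 - A) := by
        rw [hPe, Matrix.mul_sub (1 - A)ᵀ, Matrix.sub_mul]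
      _ = _ := by
        rw [Matrix.mul_smul, Matrix.smul_mul, ← Matrix.mul_assoc, hC3, Matrix.one_mul, hC1]
  -- Expanding `h1`, the terms `P` and `Aᵀ P A` cancel and the mixed terms double.
  have h2 : (2 : ℝ) • (Aᵀ * P + P * A) = (2 : ℝ) • (-1) := by
    simp only [Matrix.transpose_add, Matrix.transpose_sub, Matrix.transpose_one, add_mul,
      sub_mul, mul_add, mul_sub, one_mul, mul_one] at h1
    rw [two_smul] at h1 ⊢
    rw [two_smul, ← sub_eq_zero]
    rw [← sub_eq_zero] at h1
    rw [← h1]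
    abel
  exact smul_right_injective _ (two_ne_zero' ℝ) h2

end Matrix

/-! ### The companion matrix and its block Lyapunov equation -/

namespace OptimalConsensus

/-- The shift rows force an eigenvector to be geometric, `v k = s ^ k * v 0`, so `v 0 ≠ 0`. The last
row then says that the polynomial at `s`, times `v 0`, vanishes. -/
theorem companion_eigenvalue_isRoot {n : ℕ} [NeZero n] (c : Fin n → ℝ) (s : ℂ) (v : Fin n → ℂ)
    (hv : v ≠ 0)
    (h : ((companion c).map Complex.ofRealHom).mulVec v = s • v) :
    Polynomial.aeval s (feedbackPolynomial c) = 0 := by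
  have hrow : ∀ i : Fin n, ∀ hi : (i : ℕ) + 1 < n, v ⟨i + 1, hi⟩ = s * v i := by
    intro i hi
    have := congrFun h i
    simp only [Matrix.mulVec, dotProduct, Matrix.map_apply, companion, hi.ne, if_false,
      Pi.smul_apply, smul_eq_mul] at this
    rw [← this, Finset.sum_eq_single ⟨i + 1, hi⟩]
    · simp
    · intro j _ hj
      rw [if_neg (fun h' => hj (Fin.ext h'))]
      simp
    · simp
  have hpow : ∀ k : ℕ, ∀ hk : k < n, v ⟨k, hk⟩ = s ^ k * v 0 := by
    intro k
    induction k with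
    | zero => intro hk; simp
    | succ k ih =>
      intro hk
      rw [hrow ⟨k, by omega⟩ hk, ih (by omega)]
      ring
  have hn : 0 < n := NeZero.pos n
  have hv0 : v 0 ≠ 0 := fun h0 => hv (funext fun k => by
    have := hpow k k.2
    simpa [h0] using this)
  have hlast := congrFun h ⟨n - 1, by omega⟩
  simp only [Matrix.mulVec, dotProduct, Matrix.map_apply, companion, Nat.sub_add_cancel hn,
    if_true, Pi.smul_apply, smul_eq_mul, hpow (n - 1) (by omega)] at hlast
  have hs : s * (s ^ (n - 1) * v 0) = s ^ n * v 0 := by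
    rw [← mul_assoc, ← pow_succ', Nat.sub_add_cancel hn]
  have h1 : (Polynomial.aeval s (feedbackPolynomial c)) * v 0 = 0 := by
    rw [hs] at hlast
    simp only [feedbackPolynomial, map_add, map_sum, map_mul, Polynomial.aeval_C, map_pow,
      Polynomial.aeval_X, add_mul, Finset.sum_mul]
    rw [← hlast, ← Finset.sum_add_distrib]
    refine Finset.sum_eq_zero fun k _ => ?_
    have hk : v k = s ^ (k : ℕ) * v 0 := hpow k k.2
    rw [hk]
    simp
    ring
  exact (mul_eq_zero.1 h1).resolve_right hv0

/-- A solution for the companion matrix itself, tensored with the identity, solves the block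
equation. Working at the level of `Fin n` keeps the index type nonempty even when `m = 0`. -/
theorem exists_posDef_lyapunov_blockCompanion {n : ℕ} [NeZero n] (c : Fin n → ℝ)
    (hc : IsHurwitz (feedbackPolynomial c)) (m : ℕ) :
    ∃ P : Matrix (Fin n × Fin m) (Fin n × Fin m) ℝ, P.PosDef ∧
      (blockCompanion c m).transpose * P + P * blockCompanion c m = -1 := by
  obtain ⟨P, hP, hPe⟩ := Matrix.exists_posDef_lyapunov (companion c)
    fun s v hv h => hc s (companion_eigenvalue_isRoot c s v hv h)
  refine ⟨P ⊗ₖ 1, hP.kronecker Matrix.PosDef.one, ?_⟩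
  rw [blockCompanion, ← Matrix.kroneckerMap_transpose, Matrix.transpose_one,
    ← Matrix.mul_kronecker_mul, ← Matrix.mul_kronecker_mul, Matrix.one_mul,
    ← Matrix.add_kronecker, hPe]
  ext ⟨i, a⟩ ⟨j, b⟩
  by_cases hij : i = j <;> simp [Matrix.kroneckerMap_apply, Matrix.one_apply, hij]
  split_ifs <;> simp

end OptimalConsensus

/-! ### A quadratic Lyapunov function for strongly monotone saddle-point dynamics -/

section Saddle

variable {E F : Type*} [NormedAddCommGroup E] [InnerProductSpace ℝ E]
  [NormedAddCommGroup F] [InnerProductSpace ℝ F]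

/-- The quadratic function `σ / 2 * ‖(z, μ)‖ ^ 2 + ⟪z, K μ⟫`. -/
noncomputable def saddleLyapunov (K : F →L[ℝ] E) (σ : ℝ) (e : WithLp 2 (E × F)) : ℝ :=
  σ / 2 * ‖e‖ ^ 2 + inner ℝ (WithLp.fstL 2 ℝ E F e) (K (WithLp.sndL 2 ℝ E F e))

theorem contDiff_saddleLyapunov (K : F →L[ℝ] E) (σ : ℝ) :
    ContDiff ℝ 1 (saddleLyapunov K σ) := by
  have h1 : ContDiff ℝ 1 fun e : WithLp 2 (E × F) => ‖e‖ ^ 2 := contDiff_norm_sq ℝ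
  exact (contDiff_const.mul h1).add (ContDiff.inner ℝ (WithLp.fstL 2 ℝ E F).contDiff
    (K.comp (WithLp.sndL 2 ℝ E F)).contDiff)

theorem fderiv_saddleLyapunov (K : F →L[ℝ] E) (σ : ℝ) (e d : WithLp 2 (E × F)) :
    fderiv ℝ (saddleLyapunov K σ) e d =
      σ * inner ℝ e d + (inner ℝ e.fst (K d.snd) + inner ℝ d.fst (K e.snd)) := by
  have h1 : HasFDerivAt (fun e : WithLp 2 (E × F) => ‖e‖ ^ 2) _ e :=
    (hasStrictFDerivAt_norm_sq e).hasFDerivAt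
  have h2 := (WithLp.fstL 2 ℝ E F).hasFDerivAt (x := e)
  have h3 := (K.comp (WithLp.sndL 2 ℝ E F)).hasFDerivAt (x := e)
  have h4 := (h1.const_mul (σ / 2)).add (h2.inner ℝ h3)
  have h5 : HasFDerivAt (saddleLyapunov K σ) _ e := h4
  rw [h5.fderiv]
  simp [fderivInnerCLM_apply]
  ring

theorem abs_inner_fst_le (K : F →L[ℝ] E) {κ : ℝ} (hκ : ∀ μ, ‖K μ‖ ≤ κ * ‖μ‖)
    (z : E) (μ : F) : |inner ℝ z (K μ)| ≤ κ * (‖z‖ * ‖μ‖) :=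
  calc _ ≤ ‖z‖ * ‖K μ‖ := abs_real_inner_le_norm _ _
    _ ≤ ‖z‖ * (κ * ‖μ‖) := by gcongr; exact hκ μ
    _ = _ := by ring

/-- The saddle-point dynamics `z' = -h z - K μ`, `μ' = K† z` with `h` strongly monotone and
Lipschitz at the origin and `K` bounded below has a smooth quadratic Lyapunov function. -/
theorem exists_saddle_lyapunov (K : F →L[ℝ] E) (K' : E → F)
    (hadj : ∀ μ z, inner ℝ (K μ) z = inner ℝ μ (K' z)) (h : E → E)
    {ω θ k κ : ℝ} (hω : 0 < ω) (hθ : 0 < θ) (hk : 0 < k) (hκ0 : 0 < κ)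
    (hmono : ∀ z, ω * ‖z‖ ^ 2 ≤ inner ℝ (h z) z) (hlip : ∀ z, ‖h z‖ ≤ θ * ‖z‖)
    (hlow : ∀ μ, k * ‖μ‖ ≤ ‖K μ‖) (hκ : ∀ μ, ‖K μ‖ ≤ κ * ‖μ‖) (hκ' : ∀ z, ‖K' z‖ ≤ κ * ‖z‖) :
    ∃ (V : WithLp 2 (E × F) → ℝ) (c₁ c₂ c₃ c₄ : ℝ), ContDiff ℝ 1 V ∧
      0 < c₁ ∧ 0 < c₂ ∧ 0 < c₃ ∧ 0 < c₄ ∧ (∀ e, c₁ * ‖e‖ ^ 2 ≤ V e) ∧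
      (∀ e, V e ≤ c₂ * ‖e‖ ^ 2) ∧
      (∀ e, fderiv ℝ V e (WithLp.toLp 2 (-h e.fst - K e.snd, K' e.fst)) ≤ -c₃ * ‖e‖ ^ 2) ∧
      ∀ e, ‖fderiv ℝ V e‖ ≤ c₄ * ‖e‖ := by
  -- The summand `κ + 1` lets the squared norm absorb the cross term, giving the lower constant `1 /
  -- 2`. The quotient by `ω` makes `σ ω` dominate the terms in `‖z‖²` that differentiating the cross
  -- term produces.
  set σ : ℝ := κ + 1 + (κ ^ 2 + θ ^ 2 * κ ^ 2 / (2 * k ^ 2) + 1) / ω with hσ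
  have hσ1 : κ + 1 ≤ σ := le_add_of_nonneg_right (by positivity)
  have hσ2 : κ ^ 2 + θ ^ 2 * κ ^ 2 / (2 * k ^ 2) + 1 ≤ σ * ω := by
    rw [hσ, add_mul, div_mul_cancel₀ _ hω.ne']
    exact le_add_of_nonneg_left (by positivity)
  have hnorm : ∀ e : WithLp 2 (E × F), ‖e‖ ^ 2 = ‖e.fst‖ ^ 2 + ‖e.snd‖ ^ 2 :=
    WithLp.prod_norm_sq_eq_of_L2
  have hcross : ∀ e : WithLp 2 (E × F), |inner ℝ e.fst (K e.snd)| ≤ κ / 2 * ‖e‖ ^ 2 := by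
    intro e
    refine (abs_inner_fst_le K hκ _ _).trans ?_
    rw [hnorm]
    nlinarith [sq_nonneg (‖e.fst‖ - ‖e.snd‖)]
  refine ⟨saddleLyapunov K σ, 1 / 2, (σ + κ) / 2, min 1 (k ^ 2 / 2), σ + 2 * κ,
    contDiff_saddleLyapunov K σ, by positivity, by linarith, by positivity, by linarith,
    fun e => ?_, fun e => ?_, fun e => ?_, fun e => ?_⟩
  · have h1 := (abs_le.1 (hcross e)).1
    have h2 : 0 ≤ ‖e‖ ^ 2 := by positivity
    simp only [saddleLyapunov, WithLp.fstL_apply, WithLp.sndL_apply]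
    nlinarith
  · have h1 := (abs_le.1 (hcross e)).2
    simp only [saddleLyapunov, WithLp.fstL_apply, WithLp.sndL_apply]
    linarith
  · rw [fderiv_saddleLyapunov, WithLp.prod_inner_apply]
    simp only [WithLp.ofLp_fst, WithLp.ofLp_snd, WithLp.toLp_fst, WithLp.toLp_snd]
    set z := e.fst
    set μ := e.snd
    have e1 : inner ℝ z (-h z - K μ) = -inner ℝ (h z) z - inner ℝ μ (K' z) := by
      rw [inner_sub_right, inner_neg_right, real_inner_comm, ← hadj, real_inner_comm z (K μ)]
    have e2 : inner ℝ z (K (K' z)) = ‖K' z‖ ^ 2 := by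
      rw [real_inner_comm, hadj, real_inner_self_eq_norm_sq]
    have e3 : inner ℝ (-h z - K μ) (K μ) = -inner ℝ (h z) (K μ) - ‖K μ‖ ^ 2 := by
      rw [inner_sub_left, inner_neg_left, real_inner_self_eq_norm_sq]
    rw [e1, e2, e3, hnorm]
    have b1 : ω * ‖z‖ ^ 2 ≤ inner ℝ (h z) z := hmono z
    have b2 : ‖K' z‖ ^ 2 ≤ κ ^ 2 * ‖z‖ ^ 2 := by
      rw [← mul_pow]; exact pow_le_pow_left₀ (norm_nonneg _) (hκ' z) 2
    have b3 : -inner ℝ (h z) (K μ) ≤ (θ * ‖z‖) * (κ * ‖μ‖) := by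
      refine (neg_le_abs _).trans ((abs_real_inner_le_norm _ _).trans ?_)
      gcongr
      · exact hlip z
      · exact hκ μ
    have b4 : k ^ 2 * ‖μ‖ ^ 2 ≤ ‖K μ‖ ^ 2 := by
      rw [← mul_pow]; exact pow_le_pow_left₀ (by positivity) (hlow μ) 2
    -- Young's inequality, weighted to spend only half of the decay `k² ‖μ‖²` contributed by the
    -- cross term.
    have b5 : (θ * ‖z‖) * (κ * ‖μ‖) ≤
        θ ^ 2 * κ ^ 2 / (2 * k ^ 2) * ‖z‖ ^ 2 + k ^ 2 / 2 * ‖μ‖ ^ 2 := by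
      have : θ ^ 2 * κ ^ 2 / (2 * k ^ 2) * ‖z‖ ^ 2 + k ^ 2 / 2 * ‖μ‖ ^ 2 -
          (θ * ‖z‖) * (κ * ‖μ‖) = (θ * κ * ‖z‖ / k - k * ‖μ‖) ^ 2 / 2 := by
        field_simp; ring
      nlinarith [sq_nonneg (θ * κ * ‖z‖ / k - k * ‖μ‖)]
    have b6 : min 1 (k ^ 2 / 2) * ‖z‖ ^ 2 ≤ 1 * ‖z‖ ^ 2 := by gcongr; exact min_le_left _ _
    have b7 : min 1 (k ^ 2 / 2) * ‖μ‖ ^ 2 ≤ k ^ 2 / 2 * ‖μ‖ ^ 2 := by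
      gcongr; exact min_le_right _ _
    have b8 := mul_le_mul_of_nonneg_right hσ2 (sq_nonneg ‖z‖)
    have b9 := mul_le_mul_of_nonneg_left b1 (by linarith : 0 ≤ σ)
    nlinarith
  · refine ContinuousLinearMap.opNorm_le_bound _ (by positivity) fun d => ?_
    rw [fderiv_saddleLyapunov, Real.norm_eq_abs]
    have hfst : ∀ e : WithLp 2 (E × F), ‖e.fst‖ ≤ ‖e‖ := WithLp.norm_fst_le E
    have hsnd : ∀ e : WithLp 2 (E × F), ‖e.snd‖ ≤ ‖e‖ := WithLp.norm_snd_le E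
    have a1 : |σ * inner ℝ e d| ≤ σ * (‖e‖ * ‖d‖) := by
      rw [abs_mul, abs_of_nonneg (by linarith : 0 ≤ σ)]
      gcongr
      exact abs_real_inner_le_norm _ _
    have a2 : |inner ℝ e.fst (K d.snd)| ≤ κ * (‖e‖ * ‖d‖) := by
      refine (abs_inner_fst_le K hκ _ _).trans ?_
      gcongr
      exacts [hfst e, hsnd d]
    have a3 : |inner ℝ d.fst (K e.snd)| ≤ κ * (‖e‖ * ‖d‖) := by
      refine (abs_inner_fst_le K hκ _ _).trans ?_
      rw [mul_comm ‖e‖]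
      gcongr
      exacts [hfst d, hsnd e]
    calc _ ≤ |σ * inner ℝ e d| + (|inner ℝ e.fst (K d.snd)| + |inner ℝ d.fst (K e.snd)|) :=
          (abs_add_le _ _).trans (by gcongr; exact abs_add_le _ _)
      _ ≤ σ * (‖e‖ * ‖d‖) + (κ * (‖e‖ * ‖d‖) + κ * (‖e‖ * ‖d‖)) := by gcongr
      _ = _ := by ring

end Saddle

namespace OptimalConsensus

/-! ### Graph Laplacian and Kronecker action -/

/-- Extend the unit vector `r_N` to an orthonormal basis whose member at index `0` is `r_N`; `R`
consists of the other columns, and the identities are blocks of `Oᵀ O = 1` and `O Oᵀ = 1`. -/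
theorem exists_isOrthogonalComplement {N : ℕ} (hN : 0 < N) :
    ∃ R : Matrix (Fin N) (Fin (N - 1)) ℝ, IsOrthogonalComplement R := by
  obtain ⟨M, rfl⟩ : ∃ M, N = M + 1 := ⟨N - 1, by omega⟩
  have hM : (0 : ℝ) < ((M + 1 : ℕ) : ℝ) := by positivity
  let r : EuclideanSpace ℝ (Fin (M + 1)) := WithLp.toLp 2 (unitOnes (M + 1))
  have hr : ‖r‖ = 1 := by
    rw [EuclideanSpace.norm_eq, Real.sqrt_eq_one]
    simp only [r, unitOnes, norm_div, norm_one, div_pow, one_pow, Real.norm_eq_abs, sq_abs,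
      Real.sq_sqrt hM.le]
    simp
    field_simp
  have hv : Orthonormal ℝ (({0} : Set (Fin (M + 1))).domRestrict fun _ => r) := by
    constructor
    · intro i; exact hr
    · intro i j hij
      exact absurd (Subsingleton.elim i j) hij
  obtain ⟨b, hb⟩ := hv.exists_orthonormalBasis_extension_of_card_eq (by simp)
  have hb0 : b 0 = r := hb 0 rfl
  let O : Matrix (Fin (M + 1)) (Fin (M + 1)) ℝ := Matrix.of fun i j => b j i
  have hO : O.transpose * O = 1 := by
    ext i j
    have := orthonormal_iff_ite.1 b.orthonormal i j
    rw [Matrix.mul_apply, Matrix.one_apply, ← this, PiLp.inner_apply]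
    exact Finset.sum_congr rfl fun k _ => by simp [O, Matrix.transpose_apply, mul_comm]
  have hO' : O * O.transpose = 1 := mul_eq_one_comm.1 hO
  have hO0 : ∀ i, O i 0 = unitOnes (M + 1) i := fun i => by
    simp only [O, Matrix.of_apply, hb0]
    rfl
  let R : Matrix (Fin (M + 1)) (Fin M) ℝ := O.submatrix id Fin.succ
  have hR1 : R.transpose.mulVec (unitOnes (M + 1)) = 0 := by
    funext j
    have := congrFun (congrFun hO (Fin.succ j)) 0
    rw [Matrix.mul_apply, Matrix.one_apply_ne (Fin.succ_ne_zero j)] at this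
    simp only [Matrix.transpose_apply, hO0] at this
    exact this
  have hR2 : R.transpose * R = 1 := by
    rw [Matrix.transpose_submatrix, ← Matrix.submatrix_mul _ _ _ _ _ Function.bijective_id, hO]
    exact Matrix.submatrix_one _ (Fin.succ_injective _)
  have hR3 : R * R.transpose = 1 - Matrix.vecMulVec (unitOnes (M + 1)) (unitOnes (M + 1)) := by
    ext i k
    have := congrFun (congrFun hO' i) k
    rw [Matrix.mul_apply, Fin.sum_univ_succ] at this
    rw [Matrix.mul_apply, Matrix.sub_apply, ← this, Matrix.vecMulVec_apply]
    simp only [Matrix.transpose_apply, hO0, add_sub_cancel_left]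
    rfl
  exact ⟨R, hR1, hR2, hR3⟩

namespace WeightedGraph

variable {N : ℕ} (G : WeightedGraph N)

theorem laplacian_transpose : G.laplacian.transpose = G.laplacian := by
  rw [laplacian, Matrix.transpose_sub, Matrix.diagonal_transpose]
  congr 1
  ext i j
  exact G.weight_symm j i

theorem laplacian_mulVec (v : Fin N → ℝ) (i : Fin N) :
    G.laplacian.mulVec v i = ∑ j, G.weight i j * (v i - v j) := by
  rw [laplacian, Matrix.sub_mulVec, Pi.sub_apply, Matrix.mulVec_diagonal]
  simp only [Matrix.mulVec, dotProduct, mul_sub, Finset.sum_sub_distrib, Finset.sum_mul]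

theorem laplacian_mulVec_unitOnes : G.laplacian.mulVec (unitOnes N) = 0 := by
  funext i
  simp [laplacian_mulVec, unitOnes]

theorem vecMulVec_unitOnes_mul_laplacian :
    Matrix.vecMulVec (unitOnes N) (unitOnes N) * G.laplacian = 0 := by
  rw [Matrix.vecMulVec_mul, ← Matrix.mulVec_transpose, G.laplacian_transpose,
    G.laplacian_mulVec_unitOnes]
  simp

/-- The quadratic form `2 vᵀ L v = ∑ a_ij (v i - v j)²` vanishes, hence so does each term. Thus `v`
is constant across edges, and connectedness propagates this along paths. -/
theorem eq_of_laplacian_mulVec_eq_zero (hG : G.IsConnected) {v : Fin N → ℝ}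
    (hv : G.laplacian.mulVec v = 0) (i j : Fin N) : v i = v j := by
  have h1 : ∑ i, ∑ j, G.weight i j * (v i - v j) ^ 2 = 0 := by
    have h2 : ∑ i, ∑ j, G.weight i j * (v i - v j) * v i = 0 := by
      refine Finset.sum_eq_zero fun i _ => ?_
      rw [← Finset.sum_mul, ← laplacian_mulVec, hv]
      simp
    have h3 : ∑ i, ∑ j, G.weight i j * (v i - v j) * v j = 0 := by
      rw [Finset.sum_comm, ← neg_eq_zero, ← h2, ← Finset.sum_neg_distrib]
      refine Finset.sum_congr rfl fun i _ => ?_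
      rw [← Finset.sum_neg_distrib]
      refine Finset.sum_congr rfl fun j _ => ?_
      rw [G.weight_symm j i]
      ring
    rw [← sub_zero (0 : ℝ)]
    nth_rw 1 [← h2]
    rw [← h3, ← Finset.sum_sub_distrib]
    refine Finset.sum_congr rfl fun i _ => ?_
    rw [← Finset.sum_sub_distrib]
    refine Finset.sum_congr rfl fun j _ => ?_
    ring
  have hnn : ∀ i j, 0 ≤ G.weight i j * (v i - v j) ^ 2 := fun i j =>
    mul_nonneg (G.weight_nonneg i j) (sq_nonneg _)
  have hadj : ∀ i j, G.toSimpleGraph.Adj i j → v i = v j := by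
    intro i j hij
    have h2 := (Finset.sum_eq_zero_iff_of_nonneg fun i _ =>
      Finset.sum_nonneg fun j _ => hnn i j).1 h1 i (Finset.mem_univ i)
    have h3 := (Finset.sum_eq_zero_iff_of_nonneg fun j _ => hnn i j).1 h2 j (Finset.mem_univ j)
    have hpos : 0 < G.weight i j := hij
    have h4 := (mul_eq_zero.1 h3).resolve_left hpos.ne'
    exact sub_eq_zero.1 (pow_eq_zero_iff two_ne_zero |>.1 h4)
  obtain ⟨p⟩ := hG.preconnected i j
  induction p with
  | nil => rfl
  | cons h _ ih => exact (hadj _ _ h).trans ih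

end WeightedGraph

section Kronecker

variable {p q r m : ℕ}

theorem kronAct_apply (M : Matrix (Fin p) (Fin q) ℝ) (v : Stacked q m) (i : Fin p) :
    kronAct M v i = ∑ j, M i j • v j := rfl

theorem kronAct_apply_apply (M : Matrix (Fin p) (Fin q) ℝ) (v : Stacked q m) (i : Fin p)
    (a : Fin m) : kronAct M v i a = M.mulVec (fun j => v j a) i := by
  simp [kronAct_apply, Matrix.mulVec, dotProduct]

theorem kronAct_add (M : Matrix (Fin p) (Fin q) ℝ) (v w : Stacked q m) :
    kronAct M (v + w) = kronAct M v + kronAct M w := by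
  ext i a
  simp [kronAct_apply, smul_add, Finset.sum_add_distrib]

theorem kronAct_smul (M : Matrix (Fin p) (Fin q) ℝ) (s : ℝ) (v : Stacked q m) :
    kronAct M (s • v) = s • kronAct M v := by
  ext i a
  simp [kronAct_apply, Finset.mul_sum, mul_left_comm]

/-- `M ⊗ I_m` as a linear map. -/
noncomputable def kronLin (m : ℕ) (M : Matrix (Fin p) (Fin q) ℝ) : Stacked q m →ₗ[ℝ] Stacked p m where
  toFun := kronAct M
  map_add' := kronAct_add M
  map_smul' := kronAct_smul M

theorem continuous_kronAct (M : Matrix (Fin p) (Fin q) ℝ) :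
    Continuous (kronAct M : Stacked q m → Stacked p m) :=
  (PiLp.continuous_toLp 2 _).comp (continuous_pi fun i => continuous_finsetSum _ fun j _ =>
    (PiLp.continuous_apply 2 _ j).const_smul (M i j))

/-- `M ⊗ I_m` as a continuous linear map. -/
noncomputable def kronCLM (m : ℕ) (M : Matrix (Fin p) (Fin q) ℝ) : Stacked q m →L[ℝ] Stacked p m :=
  ⟨kronLin m M, continuous_kronAct M⟩

@[simp]
theorem kronCLM_apply (M : Matrix (Fin p) (Fin q) ℝ) (v : Stacked q m) :
    kronCLM m M v = kronAct M v := rfl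

theorem kronAct_mul (A : Matrix (Fin p) (Fin q) ℝ) (B : Matrix (Fin q) (Fin r) ℝ)
    (v : Stacked r m) : kronAct (A * B) v = kronAct A (kronAct B v) := by
  ext i a
  simp only [kronAct_apply_apply, ← Matrix.mulVec_mulVec]

theorem kronAct_one (v : Stacked q m) : kronAct 1 v = v := by
  ext i a
  rw [kronAct_apply_apply, Matrix.one_mulVec]

theorem kronAct_sub_left (A B : Matrix (Fin p) (Fin q) ℝ) (v : Stacked q m) :
    kronAct (A - B) v = kronAct A v - kronAct B v := by
  ext i a
  simp [kronAct_apply_apply, Matrix.sub_mulVec]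

theorem kronAct_zero_left (v : Stacked q m) :
    kronAct (0 : Matrix (Fin p) (Fin q) ℝ) v = 0 := by
  ext i a
  simp [kronAct_apply_apply]

theorem inner_kronAct (M : Matrix (Fin p) (Fin q) ℝ) (v : Stacked q m) (w : Stacked p m) :
    inner ℝ (kronAct M v) w = inner ℝ v (kronAct M.transpose w) := by
  have h1 : inner ℝ (kronAct M v) w = ∑ i, ∑ j, M i j * inner ℝ (v j) (w i) := by
    simp only [PiLp.inner_apply (𝕜 := ℝ) (kronAct M v), kronAct_apply, sum_inner,
      real_inner_smul_left]
  have h2 : inner ℝ v (kronAct M.transpose w) = ∑ j, ∑ i, M i j * inner ℝ (v j) (w i) := by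
    simp only [PiLp.inner_apply (𝕜 := ℝ) v, kronAct_apply, inner_sum, real_inner_smul_right,
      Matrix.transpose_apply]
  rw [h1, h2, Finset.sum_comm]

theorem kronAct_laplacian {N : ℕ} (G : WeightedGraph N) (v : Stacked N m) (i : Fin N) :
    kronAct G.laplacian v i = ∑ j, G.weight i j • (v i - v j) := by
  ext a
  rw [kronAct_apply_apply, WeightedGraph.laplacian_mulVec]
  simp

/-- A stacked vector whose blocks sum to zero lies in the range of `L ⊗ I_m`. -/
theorem exists_kronAct_laplacian_eq {N : ℕ} (G : WeightedGraph N) (hG : G.IsConnected)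
    (g : Stacked N m) (hg : ∑ i, g i = 0) : ∃ v, kronAct G.laplacian v = g := by
  suffices h : g ∈ (kronCLM m G.laplacian).toLinearMap.range by
    obtain ⟨v, hv⟩ := h
    exact ⟨v, hv⟩
  -- In finite dimension it suffices to test `g` against vectors `u` orthogonal to the range.
  -- Symmetry of `L` puts such `u` in the kernel, so all its blocks are equal and `⟪u, g⟫` reduces
  -- to the block sum of `g`.
  rw [← Submodule.orthogonal_orthogonal (kronCLM m G.laplacian).toLinearMap.range]
  rw [Submodule.mem_orthogonal]
  intro u hu
  have hu0 : kronAct G.laplacian u = 0 := by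
    rw [← inner_self_eq_zero (𝕜 := ℝ), inner_kronAct, G.laplacian_transpose]
    rw [real_inner_comm]
    exact (Submodule.mem_orthogonal _ _).1 hu _ ⟨kronAct G.laplacian u, rfl⟩
  obtain ⟨i₀⟩ : Nonempty (Fin N) := hG.nonempty
  have hconst : ∀ i, u i = u i₀ := by
    intro i
    ext a
    refine G.eq_of_laplacian_mulVec_eq_zero hG (v := fun j => u j a) ?_ i i₀
    funext j
    rw [← kronAct_apply_apply, hu0]
    rfl
  rw [PiLp.inner_apply]
  simp only [hconst]
  rw [← inner_sum, hg, inner_zero_right]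

namespace IsOrthogonalComplement

variable {N : ℕ} {R : Matrix (Fin N) (Fin (N - 1)) ℝ}

/-- `R Rᵀ` is the projection off `r_N`, which `L` annihilates. Hence `μ = Rᵀ (lam - lamstar)`
retains everything about the multipliers that acts on `z`. -/
theorem laplacian_mul_mul_transpose (hR : IsOrthogonalComplement R) (G : WeightedGraph N) :
    G.laplacian * R * R.transpose = G.laplacian := by
  rw [Matrix.mul_assoc, hR.mul_transpose, mul_sub, mul_one, Matrix.mul_vecMulVec,
    G.laplacian_mulVec_unitOnes]
  simp

/-- `R u` lies in the kernel of `L`, so it is a multiple of `r_N`; applying `Rᵀ` gives back `u` on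
one side and `0` on the other. -/
theorem laplacian_mul_mulVec_injective (hR : IsOrthogonalComplement R) {G : WeightedGraph N}
    (hG : G.IsConnected) {u : Fin (N - 1) → ℝ}
    (hu : (G.laplacian * R).mulVec u = 0) : u = 0 := by
  rw [← Matrix.mulVec_mulVec] at hu
  obtain ⟨i₀⟩ : Nonempty (Fin N) := hG.nonempty
  have hN : (0 : ℝ) < N := by exact_mod_cast i₀.pos
  have h1 : R.mulVec u = (R.mulVec u i₀ * Real.sqrt N) • unitOnes N := by
    funext i
    rw [G.eq_of_laplacian_mulVec_eq_zero hG hu i i₀]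
    have : Real.sqrt N ≠ 0 := (Real.sqrt_pos.2 hN).ne'
    simp only [unitOnes, Pi.smul_apply, smul_eq_mul]
    field_simp
  have h2 : u = R.transpose.mulVec (R.mulVec u) := by
    rw [Matrix.mulVec_mulVec, hR.transpose_mul, Matrix.one_mulVec]
  rw [h2, h1, Matrix.mulVec_smul, hR.mul_unit, smul_zero]

/-- An injective linear map in finite dimension is bounded below. This supplies the constant `k` of
the saddle-point lemma. -/
theorem exists_le_norm_kronAct (hR : IsOrthogonalComplement R) {G : WeightedGraph N}
    (hG : G.IsConnected) (m : ℕ) :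
    ∃ k : ℝ, 0 < k ∧ ∀ μ : Stacked (N - 1) m, k * ‖μ‖ ≤ ‖kronAct (G.laplacian * R) μ‖ := by
  have hker : (kronCLM m (G.laplacian * R)).toLinearMap.ker = ⊥ := by
    rw [LinearMap.ker_eq_bot']
    intro μ hμ
    ext j a
    have := hR.laplacian_mul_mulVec_injective hG (u := fun j => μ j a) (by
      funext i
      rw [← kronAct_apply_apply]
      exact congrArg (fun v : Stacked N m => v i a) hμ)
    exact congrFun this j
  obtain ⟨K, hK, hanti⟩ := LinearMap.exists_antilipschitzWith _ hker
  refine ⟨(K : ℝ)⁻¹, by positivity, fun μ => ?_⟩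
  have h := hanti.le_mul_dist μ 0
  rw [map_zero, dist_zero_right, dist_zero_right] at h
  rw [inv_mul_le_iff₀ (by exact_mod_cast hK)]
  exact h

end IsOrthogonalComplement

end Kronecker

end OptimalConsensus

namespace OptimalConsensus

/-! ### Existence of gain data -/

theorem norm_le_mul_of_forall_norm_le {ι : Type*} [Fintype ι] {α β : ι → Type*}
    [∀ i, SeminormedAddCommGroup (α i)] [∀ i, SeminormedAddCommGroup (β i)]
    {θ : ℝ} (hθ : 0 ≤ θ) (u : PiLp 2 α) (v : PiLp 2 β) (h : ∀ i, ‖u i‖ ≤ θ * ‖v i‖) :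
    ‖u‖ ≤ θ * ‖v‖ := by
  refine abs_le_of_sq_le_sq' ?_ (by positivity) |>.2
  rw [mul_pow, PiLp.norm_sq_eq_of_L2, PiLp.norm_sq_eq_of_L2, Finset.mul_sum]
  refine Finset.sum_le_sum fun i _ => ?_
  rw [← mul_pow]
  exact pow_le_pow_left₀ (norm_nonneg _) (h i) 2

section

variable {N n m : ℕ} [NeZero n] {f : Fin N → Vec m → ℝ} {ω θ : ℝ}

/-- The stacked difference of the gradients at the shifted points and at the optimal solution. -/
noncomputable def gradientGap (f : Fin N → Vec m → ℝ) (ystar : Vec m) (z : Stacked N m) : Stacked N m :=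
  WithLp.toLp 2 fun i => gradient (f i) (ystar + z i) - gradient (f i) ystar

/-- The stacked difference of the gradients at the outputs and at the generator states. -/
noncomputable def gradientMismatch (f : Fin N → Vec m → ℝ) (ystar : Vec m) (ξ : TrackingError N n m)
    (z : Stacked N m) : Stacked N m :=
  WithLp.toLp 2 fun i => gradient (f i) (ystar + z i + ξ i 0) - gradient (f i) (ystar + z i)

theorem norm_gradientGap_le (hθ : 0 ≤ θ) (hf : ∀ i, IsStronglyConvexSmooth ω θ (f i))
    (ystar : Vec m) (z : Stacked N m) : ‖gradientGap f ystar z‖ ≤ θ * ‖z‖ :=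
  norm_le_mul_of_forall_norm_le hθ _ _ fun i => by
    simpa [gradientGap] using (hf i).lipschitz (ystar + z i) ystar

theorem norm_gradientMismatch_le (hθ : 0 ≤ θ) (hf : ∀ i, IsStronglyConvexSmooth ω θ (f i))
    (ystar : Vec m) (ξ : TrackingError N n m) (z : Stacked N m) :
    ‖gradientMismatch f ystar ξ z‖ ≤ θ * ‖ξ‖ :=
  norm_le_mul_of_forall_norm_le hθ _ _ fun i => by
    have h := (hf i).lipschitz (ystar + z i + ξ i 0) (ystar + z i)
    rw [add_sub_cancel_left] at h
    exact h.trans (by gcongr; exact PiLp.norm_apply_le (ξ i) 0)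

theorem le_inner_gradientGap (hf : ∀ i, IsStronglyConvexSmooth ω θ (f i))
    (ystar : Vec m) (z : Stacked N m) :
    ω * ‖z‖ ^ 2 ≤ inner ℝ (gradientGap f ystar z) z := by
  rw [PiLp.norm_sq_eq_of_L2, PiLp.inner_apply, Finset.mul_sum]
  refine Finset.sum_le_sum fun i _ => ?_
  simpa [gradientGap] using (hf i).strongly_convex (ystar + z i) ystar

/-- The nominal generator is a saddle flow with `K = L R ⊗ I` and, by symmetry of `L`, adjoint `Rᵀ L
⊗ I`. The triangle inequality gives the coupling constants `κ₂ = θ` and `κ₃ = θ + ‖K‖`. -/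
theorem exists_gainData (G : WeightedGraph N) (hG : G.IsConnected) (hω : 0 < ω) (hθ : 0 < θ)
    (hf : ∀ i, IsStronglyConvexSmooth ω θ (f i)) (c : Fin n → ℝ)
    (hc : IsHurwitz (feedbackPolynomial c)) (ystar : Vec m) :
    Nonempty (GainData G f c ystar) := by
  obtain ⟨i₀⟩ : Nonempty (Fin N) := hG.nonempty
  obtain ⟨R, hR⟩ := exists_isOrthogonalComplement i₀.pos
  obtain ⟨P, hP, hPe⟩ := exists_posDef_lyapunov_blockCompanion c hc m
  obtain ⟨k, hk, hlow⟩ := hR.exists_le_norm_kronAct hG m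
  set K := kronCLM m (G.laplacian * R) with hK
  set K' := kronCLM m (R.transpose * G.laplacian) with hK'
  have hadj : ∀ μ z, inner ℝ (K μ) z = inner ℝ μ (K' z) := fun μ z => by
    rw [hK, hK', kronCLM_apply, kronCLM_apply, inner_kronAct, Matrix.transpose_mul,
      G.laplacian_transpose]
  obtain ⟨V, c₁, c₂, c₃, c₄, hV, h1, h2, h3, h4, hlo, hup, hdec, hder⟩ :=
    exists_saddle_lyapunov K K' hadj (gradientGap f ystar) (κ := ‖K‖ + ‖K'‖ + 1) hω hθ hk
      (by positivity) (le_inner_gradientGap hf ystar) (norm_gradientGap_le hθ.le hf ystar) hlow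
      (fun μ => (K.le_opNorm μ).trans (by gcongr; linarith [norm_nonneg K']))
      (fun z => (K'.le_opNorm z).trans (by gcongr; linarith [norm_nonneg K]))
  refine ⟨⟨R, hR, P, hP, hPe, V, hV, c₁, c₂, c₃, c₄, h1, h2, h3, h4, hlo, hup, hdec, hder,
    θ, θ + ‖K‖, hθ, by positivity, fun ξ e => ?_⟩⟩
  calc ‖coupling G f ystar R ξ e‖
      = ‖-gradientGap f ystar e.fst - gradientMismatch f ystar ξ e.fst - K e.snd‖ := rfl
    _ ≤ ‖gradientGap f ystar e.fst‖ + ‖gradientMismatch f ystar ξ e.fst‖ + ‖K e.snd‖ := by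
      refine (norm_sub_le _ _).trans ?_
      gcongr
      refine (norm_sub_le _ _).trans ?_
      rw [norm_neg]
    _ ≤ θ * ‖e‖ + θ * ‖ξ‖ + ‖K‖ * ‖e‖ := by
      gcongr
      · exact (norm_gradientGap_le hθ.le hf ystar e.fst).trans
          (by gcongr; exact WithLp.norm_fst_le _ e)
      · exact norm_gradientMismatch_le hθ.le hf ystar ξ e.fst
      · exact (K.le_opNorm _).trans (by gcongr; exact WithLp.norm_snd_le _ e)
    _ = _ := by ring

namespace GainData

variable {G : WeightedGraph N} {c : Fin n → ℝ} {ystar : Vec m} (D : GainData G f c ystar)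

theorem inputGain_nonneg : 0 ≤ D.inputGain := norm_nonneg _

theorem theta₂_nonneg : 0 ≤ D.theta₂ :=
  mul_nonneg (mul_nonneg two_pos.le D.κ₂_pos.le) D.inputGain_nonneg

theorem theta₃_nonneg : 0 ≤ D.theta₃ :=
  mul_nonneg (mul_nonneg two_pos.le D.κ₃_pos.le) D.inputGain_nonneg

theorem theta₄_pos (hθ : 0 < θ) : 0 < D.theta₄ θ :=
  add_pos_of_nonneg_of_pos D.theta₃_nonneg (mul_pos D.c₄_pos hθ)

theorem epsStar_pos (hθ : 0 < θ) : 0 < D.epsStar θ := by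
  have h2 := D.theta₂_nonneg
  have h3 := D.c₃_pos
  have h4 := D.theta₄_pos hθ
  unfold epsStar
  positivity

end GainData

end

end OptimalConsensus

/-! ### Quadratic forms and exponential decay -/

/-- A scalar function with `u' ≤ -β u` on `[0, ∞)` decays exponentially. -/
theorem le_mul_exp_of_deriv_le {u u' : ℝ → ℝ} {β : ℝ}
    (hu : ∀ t, 0 ≤ t → HasDerivWithinAt u (u' t) (Set.Ici 0) t)
    (hle : ∀ t, 0 ≤ t → u' t ≤ -β * u t) {t : ℝ} (ht : 0 ≤ t) :
    u t ≤ u 0 * Real.exp (-β * t) := by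
  have hd : ∀ t, 0 ≤ t → HasDerivWithinAt (fun s => u s * Real.exp (β * s))
      (u' t * Real.exp (β * t) + u t * (Real.exp (β * t) * β)) (Set.Ici 0) t := by
    intro t ht
    have h1 : HasDerivAt (fun s : ℝ => Real.exp (β * s)) (Real.exp (β * t) * β) t := by
      simpa using ((hasDerivAt_id t).const_mul β).exp
    exact (hu t ht).mul h1.hasDerivWithinAt
  have hanti : AntitoneOn (fun s => u s * Real.exp (β * s)) (Set.Ici 0) := by
    refine antitoneOn_of_hasDerivWithinAt_nonpos (convex_Ici 0)
      (fun s hs => (hd s hs).continuousWithinAt)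
      (fun s hs => (hd s (interior_subset hs)).mono interior_subset) fun s hs => ?_
    have := hle s (interior_subset hs)
    have he := Real.exp_pos (β * s)
    nlinarith
  have h := hanti Set.self_mem_Ici ht ht
  simp only [mul_zero, Real.exp_zero, mul_one] at h
  rw [neg_mul, Real.exp_neg, ← div_eq_mul_inv, le_div_iff₀ (Real.exp_pos _)]
  exact h

/-- A quadratic form `-a p² - c q² + b p q` with `b² < 4 a c` is negative definite. -/
theorem exists_quadratic_le {a b c : ℝ} (ha : 0 < a) (hc : 0 < c) (h : b ^ 2 < 4 * a * c) :
    ∃ δ : ℝ, 0 < δ ∧ ∀ p q : ℝ, -a * p ^ 2 - c * q ^ 2 + b * (p * q) ≤ -δ * (p ^ 2 + q ^ 2) := by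
  have hD : 0 < (4 * a * c - b ^ 2) / (4 * (a + c)) := div_pos (by linarith) (by positivity)
  refine ⟨(4 * a * c - b ^ 2) / (4 * (a + c)), hD, fun p q => ?_⟩
  -- With this `δ`, `4 (a - δ) (c - δ) = b² + 4 δ²`, so the form shifted by `δ` still has the right
  -- discriminant.
  set δ := (4 * a * c - b ^ 2) / (4 * (a + c)) with hδ
  have hδ1 : 4 * (a + c) * δ = 4 * a * c - b ^ 2 := by
    rw [hδ]; field_simp
  have h1 : δ < a := by
    rw [hδ, div_lt_iff₀ (by positivity)]
    nlinarith [sq_nonneg b, mul_pos ha ha]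
  have h2 : b ^ 2 ≤ 4 * (a - δ) * (c - δ) := by nlinarith [sq_nonneg δ]
  have h3 : 0 ≤ (a - δ) * ((a - δ) * p ^ 2 + (c - δ) * q ^ 2 - b * (p * q)) := by
    nlinarith [sq_nonneg (2 * (a - δ) * p - b * q), mul_le_mul_of_nonneg_right h2 (sq_nonneg q)]
  have h4 := nonneg_of_mul_nonneg_right h3 (by linarith)
  linarith

open Matrix in
theorem HasDerivWithinAt.dotProduct_mulVec {ι : Type*} [Fintype ι] (P : Matrix ι ι ℝ)
    {X : ℝ → ι → ℝ} {X' : ι → ℝ} {s : Set ℝ} {t : ℝ} (hX : HasDerivWithinAt X X' s t) :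
    HasDerivWithinAt (fun τ => X τ ⬝ᵥ P *ᵥ X τ) (X' ⬝ᵥ P *ᵥ X t + X t ⬝ᵥ P *ᵥ X') s t := by
  have hc := hasDerivWithinAt_pi.1 hX
  have h : ∀ i, HasDerivWithinAt (fun τ => X τ i * ∑ j, P i j * X τ j)
      (X' i * ∑ j, P i j * X t j + X t i * ∑ j, P i j * X' j) s t := fun i =>
    (hc i).mul (HasDerivWithinAt.fun_sum fun j _ => (hc j).const_mul (P i j))
  have h2 := HasDerivWithinAt.fun_sum fun i (_ : i ∈ Finset.univ) => h i
  rw [Finset.sum_add_distrib] at h2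
  exact h2

open Matrix in
/-- The derivative of the quadratic form of a solution `P` of the Lyapunov equation along
`a • A X + B v`. -/
theorem Matrix.lyapunov_derivative {ι κ : Type*} [Fintype ι] [DecidableEq ι] [Fintype κ]
    {A P : Matrix ι ι ℝ} (hP : Pᵀ = P) (hA : Aᵀ * P + P * A = -1) (B : Matrix ι κ ℝ) (a : ℝ)
    (X : ι → ℝ) (v : κ → ℝ) :
    (a • (A *ᵥ X) + B *ᵥ v) ⬝ᵥ P *ᵥ X + X ⬝ᵥ P *ᵥ (a • (A *ᵥ X) + B *ᵥ v) =
      -a * (X ⬝ᵥ X) + 2 * (X ⬝ᵥ (P * B) *ᵥ v) := by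
  have hsymm : ∀ u w : ι → ℝ, u ⬝ᵥ P *ᵥ w = w ⬝ᵥ P *ᵥ u := fun u w => by
    rw [Matrix.dotProduct_mulVec, ← Matrix.mulVec_transpose, hP, dotProduct_comm]
  have h1 : (A *ᵥ X) ⬝ᵥ P *ᵥ X + X ⬝ᵥ P *ᵥ (A *ᵥ X) = -(X ⬝ᵥ X) := by
    have h2 : (A *ᵥ X) ⬝ᵥ P *ᵥ X = X ⬝ᵥ (Aᵀ * P) *ᵥ X := by
      rw [← Matrix.mulVec_mulVec, Matrix.dotProduct_mulVec X, Matrix.vecMul_transpose]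
    rw [h2, Matrix.mulVec_mulVec, ← dotProduct_add, ← Matrix.add_mulVec, hA, Matrix.neg_mulVec,
      Matrix.one_mulVec, dotProduct_neg]
  rw [hsymm (a • (A *ᵥ X) + B *ᵥ v) X, Matrix.mulVec_add, dotProduct_add, Matrix.mulVec_smul,
    dotProduct_smul, smul_eq_mul, Matrix.mulVec_mulVec X P A, Matrix.mulVec_mulVec]
  rw [hsymm (A *ᵥ X) X, Matrix.mulVec_mulVec] at h1
  linear_combination a * h1

open Matrix in
/-- A positive definite quadratic form is bounded below by a multiple of the squared norm. -/
theorem Matrix.PosDef.exists_le_dotProduct_mulVec {ι : Type*} [Fintype ι] {P : Matrix ι ι ℝ}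
    (hP : P.PosDef) : ∃ w : ℝ, 0 < w ∧
      ∀ X : EuclideanSpace ℝ ι, w * ‖X‖ ^ 2 ≤ X.ofLp ⬝ᵥ P *ᵥ X.ofLp := by
  let q : EuclideanSpace ℝ ι → ℝ := fun X => X.ofLp ⬝ᵥ P *ᵥ X.ofLp
  have hq : Continuous q := by
    have : Continuous fun X : EuclideanSpace ℝ ι => X.ofLp := PiLp.continuous_ofLp 2 _
    exact this.dotProduct (continuous_const.matrix_mulVec this)
  have hpos : ∀ X : EuclideanSpace ℝ ι, X ≠ 0 → 0 < q X := fun X hX => by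
    have := hP.dotProduct_mulVec_pos (x := X.ofLp) (fun h => hX (by ext i; exact congrFun h i))
    simpa using this
  -- The unit sphere is empty exactly when the space is trivial; otherwise compactness yields the
  -- smallest value of the form on it.
  obtain hs | hs := (Metric.sphere (0 : EuclideanSpace ℝ ι) 1).eq_empty_or_nonempty
  · refine ⟨1, one_pos, fun X => ?_⟩
    have hX : X = 0 := by
      by_contra h
      have : (‖X‖⁻¹ • X) ∈ Metric.sphere (0 : EuclideanSpace ℝ ι) 1 := by
        simp [norm_smul, inv_mul_cancel₀ (norm_ne_zero_iff.2 h)]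
      rw [hs] at this
      exact this
    simp [hX]
  · obtain ⟨Y, hY, hmin⟩ := (isCompact_sphere (0 : EuclideanSpace ℝ ι) 1).exists_isMinOn hs
      hq.continuousOn
    have hY1 : ‖Y‖ = 1 := by simpa using hY
    refine ⟨q Y, hpos Y (fun h => by simp [h] at hY1), fun X => ?_⟩
    by_cases hX : X = 0
    · simp [hX]
    have hXn : ‖X‖ ≠ 0 := norm_ne_zero_iff.2 hX
    have h1 : q Y ≤ q (‖X‖⁻¹ • X) := hmin (by simp [norm_smul, inv_mul_cancel₀ hXn])
    have h2 : q (‖X‖⁻¹ • X) = (‖X‖ ^ 2)⁻¹ * q X := by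
      simp only [q, WithLp.ofLp_smul, Matrix.mulVec_smul, dotProduct_smul, smul_dotProduct,
        smul_eq_mul]
      rw [← mul_assoc, sq, mul_inv]
    rw [h2, inv_mul_eq_div, le_div_iff₀ (by positivity)] at h1
    exact h1

namespace OptimalConsensus

open Matrix in
theorem abs_dotProduct_mulVec_le {ι κ : Type} [Fintype ι] [Fintype κ] [DecidableEq κ]
    (M : Matrix ι κ ℝ) (X : EuclideanSpace ℝ ι) (v : EuclideanSpace ℝ κ) :
    |X.ofLp ⬝ᵥ M *ᵥ v.ofLp| ≤ euclideanOpNorm M * (‖X‖ * ‖v‖) := by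
  have h1 : X.ofLp ⬝ᵥ M *ᵥ v.ofLp = inner ℝ X (M.toEuclideanLin v) := by
    rw [EuclideanSpace.inner_eq_star_dotProduct, Matrix.ofLp_toLpLin, Matrix.toLin'_apply, star_trivial,
      dotProduct_comm]
  have h2 : ‖M.toEuclideanLin v‖ ≤ euclideanOpNorm M * ‖v‖ :=
    (M.toEuclideanLin.toContinuousLinearMap).le_opNorm v
  rw [h1]
  calc _ ≤ ‖X‖ * ‖M.toEuclideanLin v‖ := abs_real_inner_le_norm _ _
    _ ≤ ‖X‖ * (euclideanOpNorm M * ‖v‖) := by gcongr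
    _ = _ := by ring

end OptimalConsensus

/-! ### Continuity and derivatives in Euclidean products -/

theorem PiLp.continuousSMul_real {ι : Type*} {α : ι → Type*} [∀ i, AddCommGroup (α i)]
    [∀ i, Module ℝ (α i)] [∀ i, TopologicalSpace (α i)] [∀ i, ContinuousSMul ℝ (α i)] :
    ContinuousSMul ℝ (PiLp 2 α) :=
  ⟨(PiLp.continuous_toLp 2 α).comp (f := fun p : ℝ × PiLp 2 α => p.1 • p.2.ofLp)
    (continuous_fst.smul ((PiLp.continuous_ofLp 2 α).comp continuous_snd))⟩

instance OptimalConsensus.instContinuousSMulStacked (p m : ℕ) :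
    ContinuousSMul ℝ (OptimalConsensus.Stacked p m) := PiLp.continuousSMul_real

theorem WithLp.continuousSMul_prod_real {E F : Type*} [AddCommGroup E] [Module ℝ E]
    [TopologicalSpace E] [ContinuousSMul ℝ E] [AddCommGroup F] [Module ℝ F] [TopologicalSpace F]
    [ContinuousSMul ℝ F] : ContinuousSMul ℝ (WithLp 2 (E × F)) :=
  ⟨(WithLp.prod_continuous_toLp 2 E F).comp (f := fun p : ℝ × WithLp 2 (E × F) => p.1 • p.2.ofLp)
    (continuous_fst.smul ((WithLp.prod_continuous_ofLp 2 E F).comp continuous_snd))⟩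

instance OptimalConsensus.instContinuousSMulGeneratorError (N m : ℕ) :
    ContinuousSMul ℝ (OptimalConsensus.GeneratorError N m) := WithLp.continuousSMul_prod_real

section

variable {S : Set ℝ} {t : ℝ}

theorem hasDerivWithinAt_toLp {ι : Type*} [Fintype ι] {α : ι → Type*}
    [∀ i, NormedAddCommGroup (α i)] [∀ i, NormedSpace ℝ (α i)] {u : ℝ → ∀ i, α i}
    {u' : PiLp 2 α} (h : ∀ i, HasDerivWithinAt (fun s => u s i) (u' i) S t) :
    HasDerivWithinAt (fun s => (WithLp.toLp 2 (u s) : PiLp 2 α)) u' S t :=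
  (PiLp.continuousLinearEquiv 2 ℝ α).symm.hasFDerivAt.comp_hasDerivWithinAt t
    (hasDerivWithinAt_pi.2 h)

theorem HasDerivWithinAt.piLp_apply {ι : Type*} [Fintype ι] {α : ι → Type*}
    [∀ i, NormedAddCommGroup (α i)] [∀ i, NormedSpace ℝ (α i)] {u : ℝ → PiLp 2 α}
    {u' : PiLp 2 α} (h : HasDerivWithinAt u u' S t) (i : ι) :
    HasDerivWithinAt (fun s => u s i) (u' i) S t :=
  (PiLp.proj 2 α i (𝕜 := ℝ)).hasFDerivAt.comp_hasDerivWithinAt t h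

theorem HasDerivWithinAt.toLp_prodMk {E F : Type*} [NormedAddCommGroup E] [NormedSpace ℝ E]
    [NormedAddCommGroup F] [NormedSpace ℝ F] {u : ℝ → E} {v : ℝ → F} {u' : E} {v' : F}
    (hu : HasDerivWithinAt u u' S t) (hv : HasDerivWithinAt v v' S t) :
    HasDerivWithinAt (fun s => (WithLp.toLp 2 (u s, v s) : WithLp 2 (E × F)))
      (WithLp.toLp 2 (u', v')) S t :=
  (WithLp.prodContinuousLinearEquiv 2 ℝ E F).symm.hasFDerivAt.comp_hasDerivWithinAt t
    (hu.prodMk hv)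

theorem HasDerivWithinAt.clm_apply_const {E F : Type*} [NormedAddCommGroup E] [NormedSpace ℝ E]
    [NormedAddCommGroup F] [NormedSpace ℝ F] (L : E →L[ℝ] F) {u : ℝ → E} {u' : E}
    (hu : HasDerivWithinAt u u' S t) : HasDerivWithinAt (fun s => L (u s)) (L u') S t :=
  L.hasFDerivAt.comp_hasDerivWithinAt t hu

end

namespace OptimalConsensus

/-! ### The closed loop in error coordinates -/

variable {N n m : ℕ}

/-- The scaled tracking errors `x - z, ε x', ..., ε ^ (n-1) x^(n-1)` of all agents. -/
noncomputable def trackingError [NeZero n] (ε : ℝ) (x : Fin N → Fin n → Vec m) (z : Fin N → Vec m) :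
    TrackingError N n m :=
  WithLp.toLp 2 fun i => WithLp.toLp 2 fun k =>
    ε ^ (k : ℕ) • x i k - if k = 0 then z i else 0

/-- The errors of the optimal signal generator. -/
noncomputable def generatorError (ystar : Vec m) (lamstar : Stacked N m)
    (R : Matrix (Fin N) (Fin (N - 1)) ℝ) (z lam : Fin N → Vec m) : GeneratorError N m :=
  WithLp.toLp 2 (WithLp.toLp 2 (fun i => z i - ystar),
    kronAct R.transpose (WithLp.toLp 2 lam - lamstar))

/-- Tracking errors as a vector indexed by agent, derivative order and coordinate. -/
noncomputable def flatten (ξ : TrackingError N n m) :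
    EuclideanSpace ℝ (Fin N × (Fin n × Fin m)) :=
  WithLp.toLp 2 fun p => ξ p.1 p.2.1 p.2.2

/-- Stacked vectors as a vector indexed by agent and coordinate. -/
noncomputable def flattenStacked (v : Stacked N m) : EuclideanSpace ℝ (Fin N × Fin m) :=
  WithLp.toLp 2 fun p => v p.1 p.2

theorem norm_flatten (ξ : TrackingError N n m) : ‖flatten ξ‖ = ‖ξ‖ := by
  rw [← sq_eq_sq₀ (norm_nonneg _) (norm_nonneg _), PiLp.norm_sq_eq_of_L2, PiLp.norm_sq_eq_of_L2,
    Fintype.sum_prod_type]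
  refine Finset.sum_congr rfl fun i _ => ?_
  rw [PiLp.norm_sq_eq_of_L2, Fintype.sum_prod_type]
  refine Finset.sum_congr rfl fun k _ => ?_
  rw [PiLp.norm_sq_eq_of_L2]
  rfl

theorem norm_flattenStacked (v : Stacked N m) : ‖flattenStacked v‖ = ‖v‖ := by
  rw [← sq_eq_sq₀ (norm_nonneg _) (norm_nonneg _), PiLp.norm_sq_eq_of_L2, PiLp.norm_sq_eq_of_L2,
    Fintype.sum_prod_type]
  refine Finset.sum_congr rfl fun i _ => ?_
  rw [PiLp.norm_sq_eq_of_L2]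
  rfl

theorem one_kronecker_blockCompanion_mulVec (c : Fin n → ℝ)
    (X : Fin N × (Fin n × Fin m) → ℝ) (i : Fin N) (k : Fin n) (a : Fin m) :
    ((1 : Matrix (Fin N) (Fin N) ℝ) ⊗ₖ blockCompanion c m).mulVec X (i, k, a) =
      ∑ l, companion c k l * X (i, l, a) := by
  simp [Matrix.mulVec, dotProduct, Fintype.sum_prod_type, blockCompanion,
    Matrix.kroneckerMap_apply, Matrix.one_apply]

theorem one_kronecker_blockInput_mulVec [NeZero n] (v : Fin N × Fin m → ℝ) (i : Fin N) (k : Fin n)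
    (a : Fin m) :
    ((1 : Matrix (Fin N) (Fin N) ℝ) ⊗ₖ blockInput n m).mulVec v (i, k, a) =
      -if k = 0 then v (i, a) else 0 := by
  by_cases hk : k = 0 <;>
  simp [Matrix.mulVec, dotProduct, Fintype.sum_prod_type, blockInput,
    Matrix.kroneckerMap_apply, Matrix.one_apply, hk]

/-- In scaled coordinates the closed-loop integrator is driven by the companion matrix. -/
theorem pow_smul_integrator_eq [NeZero n] {ε : ℝ} (hε : 0 < ε) (c : Fin n → ℝ) (x : Fin n → Vec m)
    (z : Vec m) (k : Fin n) :
    ε ^ (k : ℕ) • (if h : (k : ℕ) + 1 < n then x ⟨(k : ℕ) + 1, h⟩ else trackingInput ε c x z) =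
      ε⁻¹ • ∑ l, companion c k l • (ε ^ (l : ℕ) • x l - if l = 0 then z else 0) := by
  by_cases h : (k : ℕ) + 1 < n
  · rw [dif_pos h, Finset.sum_eq_single ⟨(k : ℕ) + 1, h⟩]
    · have h0 : (⟨(k : ℕ) + 1, h⟩ : Fin n) ≠ 0 := fun h' => by
        simpa using congrArg Fin.val h'
      simp only [companion, h.ne, if_false, if_true, one_smul, if_neg h0, sub_zero]
      rw [smul_smul]
      congr 1
      field_simp
      rw [pow_succ]
    · intro l _ hl
      have : (l : ℕ) ≠ k + 1 := fun h' => hl (Fin.ext h')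
      simp [companion, h.ne, this]
    · simp
  -- In the last row the input carries `1 / ε ^ n`, and the scaling `ε ^ (n-1)` leaves the factor
  -- `ε⁻¹` common to all rows.
  · have hk : (k : ℕ) + 1 = n := by omega
    have hsum : ∑ l, companion c k l • (ε ^ (l : ℕ) • x l - if l = 0 then z else 0) =
        -(c 0 • (x 0 - z) +
          ∑ l ∈ Finset.univ.erase (0 : Fin n), (ε ^ (l : ℕ) * c l) • x l) := by
      rw [← Finset.add_sum_erase _ _ (Finset.mem_univ (0 : Fin n)), neg_add,
        ← Finset.sum_neg_distrib]
      congr 1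
      · simp [companion, hk]
      · refine Finset.sum_congr rfl fun l hl => ?_
        have hl0 : l ≠ 0 := (Finset.mem_erase.1 hl).1
        simp [companion, hk, hl0, smul_smul, mul_comm]
    rw [dif_neg h, hsum, trackingInput, smul_neg, smul_neg, smul_smul]
    congr 2
    have hn : ε ^ n = ε ^ (k : ℕ) * ε := by rw [← pow_succ, hk]
    rw [hn]
    field_simp

/-- The right-hand side of the generator in error coordinates is the nominal one perturbed by the
gradient mismatch. -/
theorem nominalField_add_mismatch [NeZero n] (G : WeightedGraph N) (f : Fin N → Vec m → ℝ)
    (ystar : Vec m) (R : Matrix (Fin N) (Fin (N - 1)) ℝ) (ξ : TrackingError N n m)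
    (e : GeneratorError N m) :
    nominalField G f ystar R e +
        WithLp.toLp 2 (-gradientMismatch f ystar ξ e.fst, (0 : Stacked (N - 1) m)) =
      WithLp.toLp 2 (coupling G f ystar R ξ e, kronAct (R.transpose * G.laplacian) e.fst) := by
  have h : coupling G f ystar R ξ e = -gradientGap f ystar e.fst - gradientMismatch f ystar ξ e.fst
      - kronAct (G.laplacian * R) e.snd := rfl
  have h' : nominalField G f ystar R e = WithLp.toLp 2 (-gradientGap f ystar e.fst
      - kronAct (G.laplacian * R) e.snd, kronAct (R.transpose * G.laplacian) e.fst) := rfl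
  rw [h, h', ← WithLp.toLp_add, Prod.mk_add_mk, add_zero]
  congr 2
  abel

section Trajectory

variable [NeZero n] {G : WeightedGraph N} {f : Fin N → Vec m → ℝ} {c : Fin n → ℝ} {ε : ℝ}
  {x : ℝ → Fin N → Fin n → Vec m} {z lam : ℝ → Fin N → Vec m}

/-- A multiplier that balances the gradients at the optimal solution. -/
def IsOptimalMultiplier (G : WeightedGraph N) (f : Fin N → Vec m → ℝ) (ystar : Vec m)
    (lamstar : Stacked N m) : Prop :=
  kronAct G.laplacian lamstar = WithLp.toLp 2 fun i => -gradient (f i) ystar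

variable {ystar : Vec m} {lamstar : Stacked N m} {R : Matrix (Fin N) (Fin (N - 1)) ℝ}

/-- The gap at the generator state and the mismatch telescope to `gradient (f i) (output (x i)) -
gradient (f i) ystar`. The equation `L lamstar = -(gradient (f i) ystar)_i` cancels the constant. -/
theorem coupling_eq (hR : IsOrthogonalComplement R) (hlam : IsOptimalMultiplier G f ystar lamstar)
    (x : Fin N → Fin n → Vec m) (z lam : Fin N → Vec m) (i : Fin N) :
    coupling G f ystar R (trackingError ε x z) (generatorError ystar lamstar R z lam) i =
      -gradient (f i) (output (x i)) - ∑ j, G.weight i j • (lam i - lam j) := by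
  have h1 : kronAct (G.laplacian * R) (kronAct R.transpose (WithLp.toLp 2 lam - lamstar)) i =
      (∑ j, G.weight i j • (lam i - lam j)) + gradient (f i) ystar := by
    rw [← kronAct_mul, hR.laplacian_mul_mul_transpose, ← kronCLM_apply, map_sub, kronCLM_apply,
      kronCLM_apply, hlam, PiLp.sub_apply, kronAct_laplacian]
    simp
  have h2 : ystar + (z i - ystar) + trackingError ε x z i 0 = output (x i) := by
    simp [trackingError, output]
  have h3 : coupling G f ystar R (trackingError ε x z) (generatorError ystar lamstar R z lam) i =
      -(gradient (f i) (ystar + (z i - ystar)) - gradient (f i) ystar) -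
        (gradient (f i) (ystar + (z i - ystar) + trackingError ε x z i 0) -
          gradient (f i) (ystar + (z i - ystar))) -
        kronAct (G.laplacian * R) (kronAct R.transpose (WithLp.toLp 2 lam - lamstar)) i := rfl
  rw [h3, h1, h2]
  abel

theorem IsClosedLoopTrajectory.hasDerivWithinAt_stacked
    (h : IsClosedLoopTrajectory G f c ε x z lam) {t : ℝ} (ht : 0 ≤ t)
    (hR : IsOrthogonalComplement R) (hlam : IsOptimalMultiplier G f ystar lamstar) :
    HasDerivWithinAt (fun s => (WithLp.toLp 2 fun i => z s i - ystar : Stacked N m))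
      (coupling G f ystar R (trackingError ε (x t) (z t))
        (generatorError ystar lamstar R (z t) (lam t))) (Set.Ici 0) t := by
  refine hasDerivWithinAt_toLp fun i => ?_
  rw [coupling_eq hR hlam]
  exact (h.generator t ht i).sub_const _

theorem IsClosedLoopTrajectory.hasDerivWithinAt_multiplier
    (h : IsClosedLoopTrajectory G f c ε x z lam) {t : ℝ} (ht : 0 ≤ t) {p : ℕ}
    (M : Matrix (Fin p) (Fin N) ℝ) (lamstar : Stacked N m) (ystar : Vec m) :
    HasDerivWithinAt (fun s => kronAct M (WithLp.toLp 2 (lam s) - lamstar))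
      (kronAct (M * G.laplacian) (WithLp.toLp 2 fun i => z t i - ystar)) (Set.Ici 0) t := by
  have h1 : HasDerivWithinAt (fun s => (WithLp.toLp 2 (lam s) : Stacked N m))
      (kronAct G.laplacian (WithLp.toLp 2 fun i => z t i - ystar)) (Set.Ici 0) t := by
    refine hasDerivWithinAt_toLp fun i => ?_
    rw [kronAct_laplacian]
    simpa using h.multiplier t ht i
  rw [kronAct_mul]
  exact (h1.sub_const lamstar).clm_apply_const (kronCLM m M)

theorem IsClosedLoopTrajectory.hasDerivWithinAt_generatorError
    (h : IsClosedLoopTrajectory G f c ε x z lam) {t : ℝ} (ht : 0 ≤ t)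
    (hR : IsOrthogonalComplement R) (hlam : IsOptimalMultiplier G f ystar lamstar) :
    HasDerivWithinAt (fun s => generatorError ystar lamstar R (z s) (lam s))
      (nominalField G f ystar R (generatorError ystar lamstar R (z t) (lam t)) +
        WithLp.toLp 2 (-gradientMismatch f ystar (trackingError ε (x t) (z t))
          (generatorError ystar lamstar R (z t) (lam t)).fst, 0)) (Set.Ici 0) t := by
  have h1 := (h.hasDerivWithinAt_stacked ht hR hlam).toLp_prodMk
    (h.hasDerivWithinAt_multiplier ht R.transpose lamstar ystar)
  rwa [nominalField_add_mismatch]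

/-- Only the zeroth block contains `-z`, so `z'` enters through `blockInput` without a factor `ε⁻¹`.
This is why a small `ε` lets the companion term dominate. -/
theorem IsClosedLoopTrajectory.hasDerivWithinAt_flatten
    (h : IsClosedLoopTrajectory G f c ε x z lam) (hε : 0 < ε) {t : ℝ} (ht : 0 ≤ t)
    (zd : Stacked N m)
    (hz : HasDerivWithinAt (fun s => (WithLp.toLp 2 fun i => z s i - ystar : Stacked N m))
      zd (Set.Ici 0) t) :
    HasDerivWithinAt (fun s => (flatten (trackingError ε (x s) (z s))).ofLp)
      (ε⁻¹ • ((1 : Matrix (Fin N) (Fin N) ℝ) ⊗ₖ blockCompanion c m).mulVec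
          (flatten (trackingError ε (x t) (z t))).ofLp +
        ((1 : Matrix (Fin N) (Fin N) ℝ) ⊗ₖ blockInput n m).mulVec (flattenStacked zd).ofLp)
      (Set.Ici 0) t := by
  rw [hasDerivWithinAt_pi]
  rintro ⟨i, k, a⟩
  have hzi : HasDerivWithinAt (fun s => z s i) (zd i) (Set.Ici 0) t := by
    simpa using (hz.piLp_apply i).add_const ystar
  have hk : HasDerivWithinAt (fun s => if k = 0 then z s i else 0)
      (if k = 0 then zd i else 0) (Set.Ici 0) t := by
    split_ifs
    · exact hzi
    · exact hasDerivWithinAt_const _ _ _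
  have h2 := (((h.agent i t ht k).const_smul (ε ^ (k : ℕ))).sub hk).piLp_apply a
  rw [pow_smul_integrator_eq hε] at h2
  convert! h2 using 1
  rw [Pi.add_apply, Pi.smul_apply, one_kronecker_blockCompanion_mulVec,
    one_kronecker_blockInput_mulVec]
  have h3 : (∑ l, companion c k l • (ε ^ (l : ℕ) • x t i l - if l = 0 then z t i else 0)) a =
      ∑ l, companion c k l * flatten (trackingError ε (x t) (z t)) (i, l, a) := by
    rw [WithLp.ofLp_sum, Finset.sum_apply]
    rfl
  rw [PiLp.sub_apply, PiLp.smul_apply, h3, sub_eq_add_neg]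
  congr 2
  split_ifs <;> rfl

end Trajectory

end OptimalConsensus

namespace OptimalConsensus

/-! ### The composite Lyapunov function -/

section Energy

variable {N n m : ℕ} [NeZero n] {G : WeightedGraph N} {f : Fin N → Vec m → ℝ} {c : Fin n → ℝ}
  {ystar : Vec m}

namespace GainData

variable (D : GainData G f c ystar)

/-- `I_N ⊗ P`. -/
noncomputable def bigP : Matrix (Fin N × (Fin n × Fin m)) (Fin N × (Fin n × Fin m)) ℝ :=
  (1 : Matrix (Fin N) (Fin N) ℝ) ⊗ₖ D.P

theorem bigP_posDef : D.bigP.PosDef := Matrix.PosDef.one.kronecker D.posDef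

theorem bigP_transpose : D.bigP.transpose = D.bigP := by
  have := D.bigP_posDef.isHermitian
  rwa [Matrix.IsHermitian, Matrix.conjTranspose_eq_transpose_of_trivial] at this

theorem bigP_lyapunov :
    ((1 : Matrix (Fin N) (Fin N) ℝ) ⊗ₖ blockCompanion c m).transpose * D.bigP +
      D.bigP * ((1 : Matrix (Fin N) (Fin N) ℝ) ⊗ₖ blockCompanion c m) = -1 := by
  rw [bigP, ← Matrix.kroneckerMap_transpose, Matrix.transpose_one, ← Matrix.mul_kronecker_mul,
    ← Matrix.mul_kronecker_mul, Matrix.one_mul, ← Matrix.kronecker_add, D.lyapunov]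
  ext ⟨i, p⟩ ⟨j, q⟩
  by_cases hij : i = j <;> simp [Matrix.kroneckerMap_apply, Matrix.one_apply, hij]

theorem bigP_mul_blockInput :
    D.bigP * ((1 : Matrix (Fin N) (Fin N) ℝ) ⊗ₖ blockInput n m) =
      (1 : Matrix (Fin N) (Fin N) ℝ) ⊗ₖ (D.P * blockInput n m) := by
  rw [bigP, ← Matrix.mul_kronecker_mul, Matrix.one_mul]

/-- The composite Lyapunov function `V(e) + ξᵀ (I_N ⊗ P) ξ`. -/
noncomputable def energy (ξ : TrackingError N n m) (e : GeneratorError N m) : ℝ :=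
  D.V e + dotProduct (flatten ξ).ofLp (D.bigP.mulVec (flatten ξ).ofLp)

theorem exists_energy_bounds : ∃ a b : ℝ, 0 < a ∧ 0 < b ∧
    ∀ (ξ : TrackingError N n m) (e : GeneratorError N m),
      a * (‖ξ‖ ^ 2 + ‖e‖ ^ 2) ≤ D.energy ξ e ∧ D.energy ξ e ≤ b * (‖ξ‖ ^ 2 + ‖e‖ ^ 2) := by
  obtain ⟨w, hw, hlow⟩ := D.bigP_posDef.exists_le_dotProduct_mulVec
  have hn : 0 ≤ euclideanOpNorm D.bigP := norm_nonneg _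
  have hc₁ := D.c₁_pos
  have hc₂ := D.c₂_pos
  refine ⟨min D.c₁ w, D.c₂ + euclideanOpNorm D.bigP, lt_min hc₁ hw, by positivity,
    fun ξ e => ⟨?_, ?_⟩⟩
  · have h1 := hlow (flatten ξ)
    rw [norm_flatten] at h1
    have h2 := D.lower e
    have h3 : min D.c₁ w * ‖e‖ ^ 2 ≤ D.c₁ * ‖e‖ ^ 2 := by gcongr; exact min_le_left _ _
    have h4 : min D.c₁ w * ‖ξ‖ ^ 2 ≤ w * ‖ξ‖ ^ 2 := by gcongr; exact min_le_right _ _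
    unfold energy
    linarith
  · have h1 := (le_abs_self _).trans (abs_dotProduct_mulVec_le D.bigP (flatten ξ) (flatten ξ))
    rw [norm_flatten, ← sq] at h1
    have h2 := D.upper e
    have h3 : 0 ≤ D.c₂ * ‖ξ‖ ^ 2 := by positivity
    have h4 : 0 ≤ euclideanOpNorm D.bigP * ‖e‖ ^ 2 := by positivity
    unfold energy
    linarith

variable {ε ω θ : ℝ} {x : ℝ → Fin N → Fin n → Vec m} {z lam : ℝ → Fin N → Vec m}
  {lamstar : Stacked N m}

/-- The derivative of the composite Lyapunov function along the closed loop. -/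
theorem exists_energy_deriv_le (hθ : 0 ≤ θ) (hf : ∀ i, IsStronglyConvexSmooth ω θ (f i))
    (hlam : IsOptimalMultiplier G f ystar lamstar) (hε : 0 < ε)
    (h : IsClosedLoopTrajectory G f c ε x z lam) {t : ℝ} (ht : 0 ≤ t) :
    ∃ U' : ℝ, HasDerivWithinAt (fun s => D.energy (trackingError ε (x s) (z s))
        (generatorError ystar lamstar D.R (z s) (lam s))) U' (Set.Ici 0) t ∧
      U' ≤ -(ε⁻¹ - D.theta₂) * ‖trackingError ε (x t) (z t)‖ ^ 2 -
        D.c₃ * ‖generatorError ystar lamstar D.R (z t) (lam t)‖ ^ 2 +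
        D.theta₄ θ * (‖trackingError ε (x t) (z t)‖ *
          ‖generatorError ystar lamstar D.R (z t) (lam t)‖) := by
  have hR := D.isOrthogonalComplement
  have hz := h.hasDerivWithinAt_stacked ht hR hlam
  have hX := (h.hasDerivWithinAt_flatten hε ht _ hz).dotProduct_mulVec D.bigP
  rw [Matrix.lyapunov_derivative D.bigP_transpose D.bigP_lyapunov, D.bigP_mul_blockInput] at hX
  have hV := ((D.contDiff.differentiable one_ne_zero) _).hasFDerivAt.comp_hasDerivWithinAt t
    (h.hasDerivWithinAt_generatorError ht hR hlam)
  refine ⟨_, hV.add hX, ?_⟩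
  set ξ := trackingError ε (x t) (z t)
  set e := generatorError ystar lamstar D.R (z t) (lam t)
  have h1 : dotProduct (flatten ξ).ofLp (flatten ξ).ofLp = ‖ξ‖ ^ 2 := by
    rw [← norm_flatten, EuclideanSpace.real_norm_sq_eq]
    simp [dotProduct, sq]
  have h2 := (le_abs_self _).trans (abs_dotProduct_mulVec_le
    ((1 : Matrix (Fin N) (Fin N) ℝ) ⊗ₖ (D.P * blockInput n m)) (flatten ξ)
    (flattenStacked (coupling G f ystar D.R ξ e)))
  rw [norm_flatten, norm_flattenStacked] at h2
  -- Doubled, this bound contributes `theta₂ ‖ξ‖² + theta₃ ‖ξ‖ ‖e‖`; the mismatch bound `h4` below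
  -- adds `c₄ θ ‖ξ‖ ‖e‖`, which completes `theta₄`.
  have h3 : euclideanOpNorm ((1 : Matrix (Fin N) (Fin N) ℝ) ⊗ₖ (D.P * blockInput n m)) *
      (‖ξ‖ * ‖coupling G f ystar D.R ξ e‖) ≤
      D.inputGain * (‖ξ‖ * (D.κ₂ * ‖ξ‖ + D.κ₃ * ‖e‖)) := by
    have := D.inputGain_nonneg
    change D.inputGain * _ ≤ _
    gcongr
    exact D.coupling_bound ξ e
  have h4 : fderiv ℝ D.V e (WithLp.toLp 2
      (-gradientMismatch f ystar ξ e.fst, (0 : Stacked (N - 1) m))) ≤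
      D.c₄ * ‖e‖ * (θ * ‖ξ‖) := by
    have hn : ‖(WithLp.toLp 2 (-gradientMismatch f ystar ξ e.fst, (0 : Stacked (N - 1) m)) :
        GeneratorError N m)‖ ≤ θ * ‖ξ‖ := by
      refine le_trans (le_of_eq ?_) (norm_gradientMismatch_le hθ hf ystar ξ e.fst)
      rw [← sq_eq_sq₀ (norm_nonneg _) (norm_nonneg _), WithLp.prod_norm_sq_eq_of_L2]
      simp
    refine (le_abs_self _).trans (((fderiv ℝ D.V e).le_opNorm _).trans ?_)
    have := D.c₄_pos
    gcongr
    exact D.deriv_bound e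
  rw [map_add, h1]
  have h5 := D.decay e
  unfold theta₂ theta₄ theta₃
  linarith

/-- Clearing denominators in `ε < epsStar` gives `theta₄² < 2 c₃ (ε⁻¹ - theta₂)`, which is stronger
by a factor of two than the discriminant condition needed. -/
theorem theta₄_sq_lt (hθ : 0 < θ) (hε : 0 < ε) (hlt : ε < D.epsStar θ) :
    0 < ε⁻¹ - D.theta₂ ∧ D.theta₄ θ ^ 2 < 4 * (ε⁻¹ - D.theta₂) * D.c₃ := by
  have h3 := D.c₃_pos
  have h2 := D.theta₂_nonneg
  have h4 := D.theta₄_pos hθ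
  rw [epsStar, lt_div_iff₀ (by positivity)] at hlt
  have h5 : 2 * D.c₃ * D.theta₂ + D.theta₄ θ ^ 2 < 2 * D.c₃ * ε⁻¹ := by
    rw [← div_eq_mul_inv, lt_div_iff₀ hε]
    linarith
  have h6 : 0 < D.theta₄ θ ^ 2 := by positivity
  have h7 : 0 < 2 * D.c₃ * (ε⁻¹ - D.theta₂) := by linarith
  have h8 := pos_of_mul_pos_right h7 (by positivity)
  exact ⟨h8, by nlinarith⟩

/-- All error signals of the closed loop decay exponentially. -/
theorem exists_exponential_decay (hθ : 0 < θ) (hf : ∀ i, IsStronglyConvexSmooth ω θ (f i))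
    (hlam : IsOptimalMultiplier G f ystar lamstar) (hε : 0 < ε) (hlt : ε < D.epsStar θ) :
    ∃ α : ℝ, 0 < α ∧ ∀ (x : ℝ → Fin N → Fin n → Vec m) (z lam : ℝ → Fin N → Vec m),
      IsClosedLoopTrajectory G f c ε x z lam → ∃ C : ℝ, 0 ≤ C ∧ ∀ t : ℝ, 0 ≤ t →
        ‖trackingError ε (x t) (z t)‖ ≤ C * Real.exp (-α * t) ∧
        ‖generatorError ystar lamstar D.R (z t) (lam t)‖ ≤ C * Real.exp (-α * t) := by
  obtain ⟨ha, hb⟩ := D.theta₄_sq_lt hθ hε hlt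
  obtain ⟨δ, hδ, hquad⟩ := exists_quadratic_le ha D.c₃_pos hb
  obtain ⟨a, b, ha0, hb0, hab⟩ := D.exists_energy_bounds
  -- The energy decays at rate `δ / b`; the norms behave like its square root, which halves the
  -- rate.
  refine ⟨δ / b / 2, by positivity, fun x z lam h => ?_⟩
  set U : ℝ → ℝ := fun s => D.energy (trackingError ε (x s) (z s))
    (generatorError ystar lamstar D.R (z s) (lam s))
  choose! U' hU' hle using fun t (ht : 0 ≤ t) =>
    D.exists_energy_deriv_le hθ.le hf hlam hε h ht
  have hdecay : ∀ t, 0 ≤ t → U' t ≤ -(δ / b) * U t := by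
    intro t ht
    refine (hle t ht).trans ((hquad _ _).trans ?_)
    have h1 := (hab (trackingError ε (x t) (z t))
      (generatorError ystar lamstar D.R (z t) (lam t))).2
    have h2 : δ / b * U t ≤ δ / b * (b * (‖trackingError ε (x t) (z t)‖ ^ 2 +
        ‖generatorError ystar lamstar D.R (z t) (lam t)‖ ^ 2)) := by gcongr
    rw [← mul_assoc, div_mul_cancel₀ _ hb0.ne'] at h2
    linarith
  have hU0 : 0 ≤ U 0 := le_trans (by positivity) (hab _ _).1
  have key : ∀ t, 0 ≤ t → ∀ p q : ℝ, 0 ≤ p → a * (p ^ 2 + q ^ 2) ≤ U t →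
      p ≤ Real.sqrt (U 0 / a) * Real.exp (-(δ / b / 2) * t) := by
    intro t ht p q hp hpq
    refine abs_le_of_sq_le_sq' ?_ (by positivity) |>.2
    rw [mul_pow, Real.sq_sqrt (by positivity), ← Real.exp_nat_mul, div_mul_eq_mul_div,
      le_div_iff₀ ha0]
    have h1 := le_mul_exp_of_deriv_le hU' hdecay ht
    have h2 : ((2 : ℕ) : ℝ) * (-(δ / b / 2) * t) = -(δ / b) * t := by push_cast; ring
    rw [h2]
    nlinarith [mul_nonneg ha0.le (sq_nonneg q)]
  refine ⟨Real.sqrt (U 0 / a), Real.sqrt_nonneg _, fun t ht => ⟨?_, ?_⟩⟩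
  · exact key t ht _ _ (norm_nonneg _) (hab _ _).1
  · refine key t ht _ ‖trackingError ε (x t) (z t)‖ (norm_nonneg _) ?_
    rw [add_comm]
    exact (hab _ _).1

end GainData

end Energy

end OptimalConsensus

/-! ### Lipschitz continuity of componentwise maps -/

section Lipschitz

variable {E F : Type*} [PseudoMetricSpace E] [SeminormedAddCommGroup F]

theorem exists_lipschitzWith_pi {ι : Type*} [Fintype ι] {α : ι → Type*}
    [∀ i, PseudoMetricSpace (α i)] {g : E → ∀ i, α i}
    (h : ∀ i, ∃ K, LipschitzWith K fun p => g p i) : ∃ K, LipschitzWith K g := by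
  choose K hK using h
  refine ⟨∑ i, K i, LipschitzWith.of_dist_le_mul fun p q => ?_⟩
  refine (dist_pi_le_iff (by positivity)).2 fun i => ((hK i).dist_le_mul p q).trans ?_
  gcongr
  exact Finset.single_le_sum (fun _ _ => zero_le) (Finset.mem_univ i)

theorem exists_lipschitzWith_sub {g h : E → F} (hg : ∃ K, LipschitzWith K g)
    (hh : ∃ K, LipschitzWith K h) : ∃ K, LipschitzWith K fun p => g p - h p :=
  ⟨_, hg.choose_spec.sub hh.choose_spec⟩

theorem exists_lipschitzWith_neg {g : E → F} (hg : ∃ K, LipschitzWith K g) :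
    ∃ K, LipschitzWith K fun p => -g p :=
  ⟨_, hg.choose_spec.neg⟩

theorem exists_lipschitzWith_smul [NormedSpace ℝ F] (s : ℝ) {g : E → F}
    (hg : ∃ K, LipschitzWith K g) : ∃ K, LipschitzWith K fun p => s • g p :=
  ⟨_, (lipschitzWith_smul s).comp hg.choose_spec⟩

theorem exists_lipschitzWith_sum {ι : Type*} (S : Finset ι) {g : ι → E → F}
    (hg : ∀ i, ∃ K, LipschitzWith K (g i)) : ∃ K, LipschitzWith K fun p => ∑ i ∈ S, g i p := by
  classical
  induction S using Finset.induction_on with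
  | empty => exact ⟨0, by simpa using LipschitzWith.const (0 : F)⟩
  | insert i S hi ih =>
    simp only [Finset.sum_insert hi]
    exact ⟨_, (hg i).choose_spec.add ih.choose_spec⟩

end Lipschitz

namespace OptimalConsensus

variable {N n m : ℕ} [NeZero n]

/-! ### Well-posedness -/

/-- The closed-loop vector field. -/
noncomputable def closedLoopField (G : WeightedGraph N) (f : Fin N → Vec m → ℝ) (c : Fin n → ℝ)
    (ε : ℝ) (p : (Fin N → Fin n → Vec m) × (Fin N → Vec m) × (Fin N → Vec m)) :
    (Fin N → Fin n → Vec m) × (Fin N → Vec m) × (Fin N → Vec m) :=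
  (fun i k => if h : (k : ℕ) + 1 < n then p.1 i ⟨(k : ℕ) + 1, h⟩
      else trackingInput ε c (p.1 i) (p.2.1 i),
    fun i => -gradient (f i) (output (p.1 i)) - ∑ j, G.weight i j • (p.2.2 i - p.2.2 j),
    fun i => ∑ j, G.weight i j • (p.2.1 i - p.2.1 j))

theorem exists_lipschitzWith_closedLoopField (G : WeightedGraph N) {f : Fin N → Vec m → ℝ}
    {ω θ : ℝ} (hθ : 0 ≤ θ) (hf : ∀ i, IsStronglyConvexSmooth ω θ (f i)) (c : Fin n → ℝ) (ε : ℝ) :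
    ∃ K, LipschitzWith K (closedLoopField G f c ε) := by
  have hx : ∀ i k, ∃ K, LipschitzWith K
      fun p : (Fin N → Fin n → Vec m) × (Fin N → Vec m) × (Fin N → Vec m) => p.1 i k := fun i k =>
    ⟨_, ((LipschitzWith.eval (α := fun _ : Fin n => Vec m) k).comp
      (LipschitzWith.eval (α := fun _ : Fin N => Fin n → Vec m) i)).comp LipschitzWith.prod_fst⟩
  have hz : ∀ i, ∃ K, LipschitzWith K
      fun p : (Fin N → Fin n → Vec m) × (Fin N → Vec m) × (Fin N → Vec m) => p.2.1 i := fun i =>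
    ⟨_, ((LipschitzWith.eval (α := fun _ : Fin N => Vec m) i).comp LipschitzWith.prod_fst).comp LipschitzWith.prod_snd⟩
  have hl : ∀ i, ∃ K, LipschitzWith K
      fun p : (Fin N → Fin n → Vec m) × (Fin N → Vec m) × (Fin N → Vec m) => p.2.2 i := fun i =>
    ⟨_, ((LipschitzWith.eval (α := fun _ : Fin N => Vec m) i).comp LipschitzWith.prod_snd).comp LipschitzWith.prod_snd⟩
  have h1 : ∃ K, LipschitzWith K fun p => (closedLoopField G f c ε p).1 := by
    refine exists_lipschitzWith_pi fun i => exists_lipschitzWith_pi fun k => ?_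
    by_cases h : (k : ℕ) + 1 < n
    · simpa only [closedLoopField, dif_pos h] using hx i ⟨k + 1, h⟩
    · simp only [closedLoopField, dif_neg h, trackingInput]
      refine exists_lipschitzWith_neg (exists_lipschitzWith_smul _ ?_)
      obtain ⟨K₁, hK₁⟩ := exists_lipschitzWith_smul (c 0) (exists_lipschitzWith_sub (hx i 0) (hz i))
      obtain ⟨K₂, hK₂⟩ := exists_lipschitzWith_sum (Finset.univ.erase (0 : Fin n)) fun k =>
        exists_lipschitzWith_smul (ε ^ (k : ℕ) * c k) (hx i k)
      exact ⟨_, hK₁.add hK₂⟩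
  have h2 : ∃ K, LipschitzWith K fun p => (closedLoopField G f c ε p).2.1 := by
    refine exists_lipschitzWith_pi fun i => ?_
    refine exists_lipschitzWith_sub (exists_lipschitzWith_neg ?_) ?_
    · have hg : LipschitzWith ⟨θ, hθ⟩ (gradient (f i)) :=
        LipschitzWith.of_dist_le_mul fun a b => by
          rw [dist_eq_norm, dist_eq_norm]
          exact (hf i).lipschitz a b
      exact ⟨_, hg.comp (hx i 0).choose_spec⟩
    · exact exists_lipschitzWith_sum _ fun j =>
        exists_lipschitzWith_smul _ (exists_lipschitzWith_sub (hl i) (hl j))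
  have h3 : ∃ K, LipschitzWith K fun p => (closedLoopField G f c ε p).2.2 :=
    exists_lipschitzWith_pi fun i => exists_lipschitzWith_sum _ fun j =>
      exists_lipschitzWith_smul _ (exists_lipschitzWith_sub (hz i) (hz j))
  exact ⟨_, h1.choose_spec.prodMk (h2.choose_spec.prodMk h3.choose_spec)⟩

/-- Lipschitz gradients make the whole vector field globally Lipschitz, so no trajectory can blow up
in finite time. -/
theorem closedLoopWellPosed (G : WeightedGraph N) {f : Fin N → Vec m → ℝ} {ω θ : ℝ}
    (hθ : 0 ≤ θ) (hf : ∀ i, IsStronglyConvexSmooth ω θ (f i)) (c : Fin n → ℝ) (ε : ℝ) :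
    ClosedLoopWellPosed G f c ε := by
  intro x₀ z₀ lam₀
  obtain ⟨K, hK⟩ := exists_lipschitzWith_closedLoopField G hθ hf c ε
  obtain ⟨γ, hγ0, hγ⟩ := hK.exists_global_solution (x₀, z₀, lam₀)
  have hfst : ∀ t, 0 ≤ t → HasDerivWithinAt (fun s => (γ s).1)
      (closedLoopField G f c ε (γ t)).1 (Set.Ici 0) t := fun t ht =>
    (hγ t ht).clm_apply_const (ContinuousLinearMap.fst ℝ _ _)
  have hsnd : ∀ t, 0 ≤ t → HasDerivWithinAt (fun s => (γ s).2)
      (closedLoopField G f c ε (γ t)).2 (Set.Ici 0) t := fun t ht =>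
    (hγ t ht).clm_apply_const (ContinuousLinearMap.snd ℝ _ _)
  refine ⟨fun t => (γ t).1, fun t => (γ t).2.1, fun t => (γ t).2.2, ⟨fun i t ht k => ?_,
    fun t ht i => ?_, fun t ht i => ?_⟩, by simp [hγ0], by simp [hγ0], by simp [hγ0]⟩
  · exact hasDerivWithinAt_pi.1 (hasDerivWithinAt_pi.1 (hfst t ht) i) k
  · exact hasDerivWithinAt_pi.1 ((hsnd t ht).clm_apply_const (ContinuousLinearMap.fst ℝ _ _)) i
  · exact hasDerivWithinAt_pi.1 ((hsnd t ht).clm_apply_const (ContinuousLinearMap.snd ℝ _ _)) i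

/-! ### Convergence and boundedness -/

variable {G : WeightedGraph N} {f : Fin N → Vec m → ℝ} {c : Fin n → ℝ} {ε : ℝ} {ystar : Vec m}
  {lamstar : Stacked N m} {R : Matrix (Fin N) (Fin (N - 1)) ℝ}

/-- The average of the multipliers is conserved along the closed loop. -/
theorem IsClosedLoopTrajectory.kronAct_average_eq {x : ℝ → Fin N → Fin n → Vec m}
    {z lam : ℝ → Fin N → Vec m} (h : IsClosedLoopTrajectory G f c ε x z lam)
    (lamstar : Stacked N m) {t : ℝ} (ht : 0 ≤ t) :
    kronAct (Matrix.vecMulVec (unitOnes N) (unitOnes N)) (WithLp.toLp 2 (lam t) - lamstar) =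
      kronAct (Matrix.vecMulVec (unitOnes N) (unitOnes N)) (WithLp.toLp 2 (lam 0) - lamstar) := by
  have hd : ∀ s, 0 ≤ s → HasDerivWithinAt (fun s => kronAct
      (Matrix.vecMulVec (unitOnes N) (unitOnes N)) (WithLp.toLp 2 (lam s) - lamstar))
      0 (Set.Ici 0) s := by
    intro s hs
    -- The reference point for `z` is immaterial, since `r rᵀ L = 0`; it is taken to be `0`.
    have := h.hasDerivWithinAt_multiplier hs (Matrix.vecMulVec (unitOnes N) (unitOnes N))
      lamstar 0
    rwa [G.vecMulVec_unitOnes_mul_laplacian, kronAct_zero_left] at this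
  refine (convex_Ici (0 : ℝ)).is_const_of_fderivWithin_eq_zero (𝕜 := ℝ)
    (fun s hs => (hd s hs).differentiableWithinAt) (fun s hs => ?_) ht Set.self_mem_Ici
  rw [(hd s hs).hasFDerivWithinAt.fderivWithin (uniqueDiffOn_Ici 0 s hs)]
  ext
  simp

theorem norm_output_sub_le (x : Fin N → Fin n → Vec m) (z lam : Fin N → Vec m) (i : Fin N) :
    ‖output (x i) - ystar‖ ≤ ‖trackingError ε x z‖ +
      ‖generatorError ystar lamstar R z lam‖ := by
  have h1 : output (x i) - ystar =
      trackingError ε x z i 0 + (generatorError ystar lamstar R z lam).fst i := by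
    simp [trackingError, output, generatorError]
  rw [h1]
  refine (norm_add_le _ _).trans ?_
  gcongr
  · exact (PiLp.norm_apply_le (trackingError ε x z i) 0).trans (PiLp.norm_apply_le _ i)
  · exact (PiLp.norm_apply_le (generatorError ystar lamstar R z lam).fst i).trans
      (WithLp.norm_fst_le _ _)

theorem norm_generator_le (z lam : Fin N → Vec m) (i : Fin N) :
    ‖z i‖ ≤ ‖ystar‖ + ‖generatorError ystar lamstar R z lam‖ := by
  have h1 : z i = ystar + (generatorError ystar lamstar R z lam).fst i := by
    simp [generatorError]
  rw [h1]
  refine (norm_add_le _ _).trans ?_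
  gcongr
  exact (PiLp.norm_apply_le (generatorError ystar lamstar R z lam).fst i).trans
    (WithLp.norm_fst_le _ _)

theorem norm_state_le (hε : 0 < ε) (x : Fin N → Fin n → Vec m) (z : Fin N → Vec m) (i : Fin N)
    (k : Fin n) : ‖x i k‖ ≤ (ε ^ (k : ℕ))⁻¹ * (‖trackingError ε x z‖ + ‖z i‖) := by
  have h1 : ε ^ (k : ℕ) • x i k = trackingError ε x z i k + if k = 0 then z i else 0 := by
    simp [trackingError]
  have h2 : ‖ε ^ (k : ℕ) • x i k‖ ≤ ‖trackingError ε x z‖ + ‖z i‖ := by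
    rw [h1]
    refine (norm_add_le _ _).trans ?_
    gcongr
    · exact (PiLp.norm_apply_le (trackingError ε x z i) k).trans (PiLp.norm_apply_le _ i)
    · split_ifs <;> simp
  rw [norm_smul, Real.norm_of_nonneg (by positivity)] at h2
  rwa [← div_eq_inv_mul, le_div_iff₀' (by positivity)]

/-- Since `1 = R Rᵀ + r rᵀ`, `lam - lamstar` splits into `R μ`, controlled by the generator error,
and its average part, which is constant along trajectories. -/
theorem norm_multiplier_le (hR : IsOrthogonalComplement R) (z lam : Fin N → Vec m) (i : Fin N) :
    ‖lam i‖ ≤ ‖lamstar‖ + ‖kronCLM m R‖ * ‖generatorError ystar lamstar R z lam‖ +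
      ‖kronAct (Matrix.vecMulVec (unitOnes N) (unitOnes N)) (WithLp.toLp 2 lam - lamstar)‖ := by
  set r := Matrix.vecMulVec (unitOnes N) (unitOnes N) with hr
  have h1 : (WithLp.toLp 2 lam : Stacked N m) = lamstar +
      kronCLM m R (generatorError ystar lamstar R z lam).snd +
      kronAct r (WithLp.toLp 2 lam - lamstar) := by
    have h2 : kronCLM m R (generatorError ystar lamstar R z lam).snd =
        (WithLp.toLp 2 lam - lamstar) - kronAct r (WithLp.toLp 2 lam - lamstar) := by
      rw [kronCLM_apply, generatorError, WithLp.toLp_snd, ← kronAct_mul, hR.mul_transpose,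
        kronAct_sub_left, kronAct_one]
    rw [h2]
    abel
  have h3 : ‖lam i‖ ≤ ‖(WithLp.toLp 2 lam : Stacked N m)‖ :=
    PiLp.norm_apply_le (WithLp.toLp 2 lam : Stacked N m) i
  refine h3.trans ((le_of_eq (congrArg norm h1)).trans ?_)
  refine (norm_add_le _ _).trans ?_
  gcongr
  refine (norm_add_le _ _).trans ?_
  gcongr
  exact ((kronCLM m R).le_opNorm _).trans (by gcongr; exact WithLp.norm_snd_le _ _)

theorem outputsConvergeExponentially_and_solves {ω θ : ℝ} (hθ : 0 < θ)
    (hf : ∀ i, IsStronglyConvexSmooth ω θ (f i)) (hlam : IsOptimalMultiplier G f ystar lamstar)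
    (D : GainData G f c ystar) (hε : 0 < ε) (hlt : ε < D.epsStar θ) :
    SolvesOptimalOutputConsensus G f c ε ystar ∧
      OutputsConvergeExponentially G f c ε ystar := by
  obtain ⟨α, hα, hdecay⟩ := D.exists_exponential_decay hθ hf hlam hε hlt
  have hout : ∀ (x : ℝ → Fin N → Fin n → Vec m) (z lam : ℝ → Fin N → Vec m),
      IsClosedLoopTrajectory G f c ε x z lam → ∃ C : ℝ, ∀ t : ℝ, 0 ≤ t → ∀ i,
        ‖output (x t i) - ystar‖ ≤ C * Real.exp (-α * t) := by
    intro x z lam h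
    obtain ⟨C, -, hC⟩ := hdecay x z lam h
    refine ⟨2 * C, fun t ht i => ?_⟩
    obtain ⟨h1, h2⟩ := hC t ht
    have := norm_output_sub_le (ε := ε) (ystar := ystar) (lamstar := lamstar) (R := D.R)
      (x t) (z t) (lam t) i
    linarith
  refine ⟨⟨closedLoopWellPosed G hθ.le hf c ε, fun x z lam h => ⟨?_, fun i => ?_⟩⟩,
    α, hα, hout⟩
  · obtain ⟨C, hC0, hC⟩ := hdecay x z lam h
    have hexp : ∀ t : ℝ, 0 ≤ t → C * Real.exp (-α * t) ≤ C := fun t ht =>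
      mul_le_of_le_one_right hC0 (Real.exp_le_one_iff.2 (by nlinarith))
    set Bz := ‖ystar‖ + C
    set Bx := ∑ k : Fin n, (ε ^ (k : ℕ))⁻¹ * (C + Bz)
    set Bl := ‖lamstar‖ + ‖kronCLM m D.R‖ * C + ‖kronAct (Matrix.vecMulVec (unitOnes N)
      (unitOnes N)) (WithLp.toLp 2 (lam 0) - lamstar)‖
    refine ⟨max Bx (max Bz Bl), fun t ht i => ?_⟩
    have hξ := (hC t ht).1.trans (hexp t ht)
    have he := (hC t ht).2.trans (hexp t ht)
    have hz : ‖z t i‖ ≤ Bz := (norm_generator_le (R := D.R) (lamstar := lamstar)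
      (ystar := ystar) (z t) (lam t) i).trans (by simp only [Bz]; gcongr)
    refine ⟨fun k => le_max_of_le_left ?_, le_max_of_le_right (le_max_of_le_left hz),
      le_max_of_le_right (le_max_of_le_right ?_)⟩
    · refine (norm_state_le hε (x t) (z t) i k).trans ?_
      calc _ ≤ (ε ^ (k : ℕ))⁻¹ * (C + Bz) := by gcongr
        _ ≤ Bx := Finset.single_le_sum (f := fun k : Fin n => (ε ^ (k : ℕ))⁻¹ * (C + Bz))
          (fun k _ => by positivity) (Finset.mem_univ k)
    · refine (norm_multiplier_le (lamstar := lamstar) (ystar := ystar) D.isOrthogonalComplement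
        (z t) (lam t) i).trans ?_
      rw [h.kronAct_average_eq lamstar ht]
      simp only [Bl]
      gcongr
  · obtain ⟨C, hC⟩ := hout x z lam h
    have hlim : Filter.Tendsto (fun t : ℝ => C * Real.exp (-α * t)) Filter.atTop (nhds 0) := by
      have h1 : Filter.Tendsto (fun t : ℝ => -α * t) Filter.atTop Filter.atBot :=
        Filter.tendsto_id.const_mul_atTop_of_neg (by linarith)
      simpa using (Real.tendsto_exp_atBot.comp h1).const_mul C
    refine squeeze_zero' (Filter.Eventually.of_forall fun t => norm_nonneg _) ?_ hlim
    filter_upwards [Filter.eventually_ge_atTop 0] with t ht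
    exact hC t ht i

/-- The stationarity condition at `ystar` is exactly the solvability condition for the Laplacian
equation on a connected graph. -/
theorem exists_isOptimalMultiplier (hG : G.IsConnected)
    (hy : ∑ i, gradient (f i) ystar = 0) : ∃ lamstar, IsOptimalMultiplier G f ystar lamstar :=
  exists_kronAct_laplacian_eq G hG _ (by simpa using hy)

end OptimalConsensus

open OptimalConsensus
theorem mainTheorem5 {N n m : ℕ} [NeZero n] (G : WeightedGraph N) (hG : G.IsConnected)
    (f : Fin N → Vec m → ℝ) (ω θ : ℝ) (hω : 0 < ω) (hθ : 0 < θ)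
    (hf : ∀ i, IsStronglyConvexSmooth ω θ (f i))
    (c : Fin n → ℝ) (hc : IsHurwitz (feedbackPolynomial c)) :
    ∃ ystar : Vec m,
      (IsOptimalSolution f ystar ∧ ∀ y, IsOptimalSolution f y → y = ystar) ∧
      (∃ D : GainData G f c ystar, 0 < D.epsStar θ) ∧
      ∀ (D : GainData G f c ystar) (ε : ℝ), 0 < ε → ε < D.epsStar θ →
        SolvesOptimalOutputConsensus G f c ε ystar ∧
        OutputsConvergeExponentially G f c ε ystar := by
  obtain ⟨i₀⟩ : Nonempty (Fin N) := hG.nonempty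
  obtain ⟨ystar, hy, hopt, huniq⟩ := exists_unique_optimal i₀.pos hω hθ hf
  obtain ⟨D⟩ := exists_gainData G hG hω hθ hf c hc ystar
  obtain ⟨lamstar, hlam⟩ := exists_isOptimalMultiplier hG hy
  exact ⟨ystar, ⟨hopt, huniq⟩, ⟨D, D.epsStar_pos hθ⟩, fun D ε hε hlt =>
    outputsConvergeExponentially_and_solves hθ hf hlam D hε hlt⟩
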